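/- **Theorem (Computability).** Let $n\ge 1$. *Domains.* Let $\mathbb{I}\mathbb{R}^n$ be the set of hyperboxes $\prod_{i=1}^n[a_i,b_i]$ ($a_i\le b_i$ real) together with $\mathbb{R}^n$, and let $\mathbb{K}\mathbb{R}^n$ be the set of nonempty compact subsets of $\mathbb{R}^n$ together with $\mathbb{R}^n$; both are ordered by reverse inclusion, so that $\bot=\mathbb{R}^n$. Let $\mathbb{I}\mathbb{R}^n\Rightarrow\mathbb{I}\mathbb{R}^1$ be the set of Scott-continuous maps with the pointwise order. Elements of $\mathbb{I}\mathbb{R}^1$ are written $I=[\underline I,\overline I]$, with $\underline\bot=-\infty$ and $\overline\bot=+\infty$. As usual, $x\ll y$ means that every directed set whose supremum exists and is $\sqsupseteq y$ has an element $\sqsupseteq x$. A set $B$ is a basis of a directed-complete partial order $D$ if for every $x\in D$ the set $\{b\in B: b\ll x\}$ is directed with supremum $x$; and $D$ is effectively given by an enumeration $b_0=\bot,b_1,b_2,\dots$ of a basis if $\{(i,j): b_i\ll b_j\}$ is recursively enumerable. *Bases.* Fix the standard effective enumerations (through codes of finite lists of rational numbers) of the following sets: for $\mathbb{I}\mathbb{R}^n$,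 the set $\mathbb{R}^n$ and all hyperboxes with rational coordinates; for $\mathbb{K}\mathbb{R}^n$, the set $\mathbb{R}^n$ and all nonempty finite unions of such hyperboxes; for $\mathbb{I}\mathbb{R}^n\Rightarrow\mathbb{I}\mathbb{R}^1$, the rational step functions, that is, the suprema of the finite bounded sets of functions $e\chi_{d}$, where $d$ and $e$ are basis elements of $\mathbb{I}\mathbb{R}^n$ and $\mathbb{I}\mathbb{R}^1$, $e\chi_d(x)=e$ if $d\ll x$, and $e\chi_d(x)=\bot$ otherwise. *Computability.* Let $D$, $E$ be effectively given by $(b_i)$, $(c_i)$. A name of $x\in D$ is a sequence $p\in\mathbb{N}^{\mathbb{N}}$ with $\{p(k):k\in\mathbb{N}\}=\{i: b_i\ll x\}$, and likewise in $E$. A map $f:D\to E$ is TTE-computable if some Type-2 computable partial function on $\mathbb{N}^{\mathbb{N}}$ (one induced by a computable prefix-monotone word function) maps every name of every $x\in D$ to a name of $f(x)$. The map $f$ is computable in the sense of effectively given domains if it is Scott-continuous and $\{(i,j): c_i\ll f(b_j)\}$ is recursively enumerable. *Maximum value and maximum set.* For $f\in\mathbb{I}\mathbb{R}^n\Rightarrow\mathbb{I}\mathbb{R}^1$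 and a nonempty compact $X\subseteq\mathbb{R}^n$, put $\underline z=\sup_{x\in X}\underline{f(\{x\})}$ and $\overline z=\sup_{x\in X}\overline{f(\{x\})}$ in $[-\infty,+\infty]$. Let $\operatorname{maxV}(f,X)=[\underline z,\overline z]$, understood as $\bot$ if this is not a compact interval of real numbers, and let $\operatorname{maxS}(f,X)=\{x\in X: f(\{x\})\cap[\underline z,\overline z]\ne\emptyset\}$, the intersection being taken in $[-\infty,+\infty]$. *Claim.* Let $X\subseteq\mathbb{R}^n$ be a nonempty finite union of hyperboxes with rational coordinates. Then the domains $\mathbb{I}\mathbb{R}^n\Rightarrow\mathbb{I}\mathbb{R}^1$, $\mathbb{I}\mathbb{R}^1$, $\mathbb{I}\mathbb{R}^n$ and $\mathbb{K}\mathbb{R}^n$ are effectively given by the above enumerations; for every $f\in\mathbb{I}\mathbb{R}^n\Rightarrow\mathbb{I}\mathbb{R}^1$ the set $\operatorname{maxS}(f,X)$ is nonempty and compact; and the functionals $$\operatorname{maxV}(\cdot,X):(\mathbb{I}\mathbb{R}^n\Rightarrow\mathbb{I}\mathbb{R}^1)\to\mathbb{I}\mathbb{R}^1,\qquad \operatorname{maxS}(\cdot,X):(\mathbb{I}\mathbb{R}^n\Rightarrow\mathbb{I}\mathbb{R}^1)\to\mathbb{K}\mathbb{R}^n$$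 are computable, both in the sense of effectively given domains and in the sense of TTE. -/

import Mathlib

/-! ### Domains -/

/-- The way-below relation `x ≪ y` of a partially ordered set. -/
def WayBelow {D : Type*} [PartialOrder D] (x y : D) : Prop :=
  ∀ (S : Set D) (s : D), S.Nonempty → DirectedOn (· ≤ ·) S → IsLUB S s → y ≤ s →
    ∃ d ∈ S, x ≤ d

/-- Directed completeness: every (nonempty) directed subset has a least upper bound. -/
def IsDCPO (D : Type*) [PartialOrder D] : Prop :=
  ∀ S : Set D, S.Nonempty → DirectedOn (· ≤ ·) S → ∃ s, IsLUB S s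

/-- `B` is a basis of `D`: for every `x`, the elements of `B` that are way below `x` form a
directed set with supremum `x`. -/
def IsDomainBasis {D : Type*} [PartialOrder D] (B : Set D) : Prop :=
  ∀ x : D, {a | a ∈ B ∧ WayBelow a x}.Nonempty ∧
    DirectedOn (· ≤ ·) {a | a ∈ B ∧ WayBelow a x} ∧ IsLUB {a | a ∈ B ∧ WayBelow a x} x

/-- `D` is an `ω`-continuous domain that is effectively given with respect to the enumeration
`b 0 = ⊥, b 1, b 2, …` of a basis: `{(i, j) | b i ≪ b j}` is recursively enumerable. -/
structure IsEffectivelyGiven {D : Type*} [PartialOrder D] (b : ℕ → D) : Prop where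
  dcpo : IsDCPO D
  bot : IsBot (b 0)
  basis : IsDomainBasis (Set.range b)
  re : REPred fun p : ℕ × ℕ => WayBelow (b p.1) (b p.2)

/-- The set of Scott-continuous maps `D ⇒ E`, ordered pointwise (as a subtype of `D → E`). -/
abbrev ScottMap (D E : Type*) [PartialOrder D] [PartialOrder E] : Type _ :=
  {f : D → E // ScottContinuous f}

/-! ### Computable maps between effectively given domains -/

/-- `p : ℕ → ℕ` is a name of `x` with respect to the enumerated basis `b` if `p` enumerates
`{i | b i ≪ x}`. -/
def IsName {D : Type*} [PartialOrder D] (b : ℕ → D) (p : ℕ → ℕ) (x : D) : Prop :=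
  Set.range p = {i | WayBelow (b i) x}

/-- The finite prefix `p 0, …, p (k - 1)`. -/
def seqPrefix (p : ℕ → ℕ) (k : ℕ) : List ℕ := (List.range k).map p

/-- Type-2 (TTE) computability of `f` with respect to the representations of `D` and `E` given by
the enumerated bases `b` and `c`: a computable monotone word function `φ`, which says which finite
output has been written when a finite prefix of the input has been read, turns every name of
every `x` into a name of `f x`. -/
def IsTTEComputable {D E : Type*} [PartialOrder D] [PartialOrder E]
    (b : ℕ → D) (c : ℕ → E) (f : D → E) : Prop :=
  ∃ φ : List ℕ → List ℕ, Computable φ ∧ (∀ u v, u <+: v → φ u <+: φ v) ∧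
    ∀ (x : D) (p : ℕ → ℕ), IsName b p x →
      ∃ q : ℕ → ℕ, IsName c q (f x) ∧ ∀ m, ∃ k, seqPrefix q m <+: φ (seqPrefix p k)

/-- Computability of `f` in the sense of effectively given domains: `f` is Scott-continuous and
`{(i, j) | c i ≪ f (b j)}` is recursively enumerable. -/
structure IsEffectiveMap {D E : Type*} [PartialOrder D] [PartialOrder E]
    (b : ℕ → D) (c : ℕ → E) (f : D → E) : Prop where
  continuous : ScottContinuous f
  re : REPred fun p : ℕ × ℕ => WayBelow (c p.1) (f (b p.2))

/-! ### The interval domain and the domain of compact sets -/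

/-- Hyperboxes `∏ᵢ [aᵢ, bᵢ]` in `ℝⁿ`. -/
def IsHyperbox {n : ℕ} (C : Set (Fin n → ℝ)) : Prop :=
  ∃ a b : Fin n → ℝ, a ≤ b ∧ C = Set.Icc a b

/-- The domain of hyperboxes of `ℝⁿ`, with `ℝⁿ` added as bottom element. -/
@[ext] structure IntervalDomain (n : ℕ) where
  carrier : Set (Fin n → ℝ)
  isBox : carrier = Set.univ ∨ IsHyperbox carrier

/-- The domain of nonempty compact subsets of `ℝⁿ`, with `ℝⁿ` added as bottom element. -/
@[ext] structure CompactDomain (n : ℕ) where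
  carrier : Set (Fin n → ℝ)
  isCompact : carrier = Set.univ ∨ (carrier.Nonempty ∧ IsCompact carrier)

/-- Reverse inclusion. -/
instance (n : ℕ) : PartialOrder (IntervalDomain n) where
  le x y := y.carrier ⊆ x.carrier
  le_refl _ := subset_rfl
  le_trans _ _ _ h₁ h₂ := Set.Subset.trans h₂ h₁
  le_antisymm _ _ h₁ h₂ := IntervalDomain.ext (Set.Subset.antisymm h₂ h₁)

/-- Reverse inclusion. -/
instance (n : ℕ) : PartialOrder (CompactDomain n) where
  le x y := y.carrier ⊆ x.carrier
  le_refl _ := subset_rfl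
  le_trans _ _ _ h₁ h₂ := Set.Subset.trans h₂ h₁
  le_antisymm _ _ h₁ h₂ := CompactDomain.ext (Set.Subset.antisymm h₂ h₁)

instance (n : ℕ) : OrderBot (IntervalDomain n) where
  bot := ⟨Set.univ, Or.inl rfl⟩
  bot_le _ := Set.subset_univ _

instance (n : ℕ) : OrderBot (CompactDomain n) where
  bot := ⟨Set.univ, Or.inl rfl⟩
  bot_le _ := Set.subset_univ _

/-- The maximal element `{x}` of the interval domain. -/
def IntervalDomain.point {n : ℕ} (x : Fin n → ℝ) : IntervalDomain n :=
  ⟨{x}, Or.inr ⟨x, x, le_rfl, (Set.Icc_self x).symm⟩⟩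

/-- The set `C` as an element of the interval domain if it is a hyperbox, and `⊥` otherwise. -/
noncomputable def IntervalDomain.ofSet {n : ℕ} (C : Set (Fin n → ℝ)) : IntervalDomain n :=
  open Classical in if h : IsHyperbox C then ⟨C, Or.inr h⟩ else ⊥

/-- The set `C` as an element of the domain of compact sets if it is nonempty and compact,
and `⊥` otherwise. -/
noncomputable def CompactDomain.ofSet {n : ℕ} (C : Set (Fin n → ℝ)) : CompactDomain n :=
  open Classical in if h : C.Nonempty ∧ IsCompact C then ⟨C, Or.inr h⟩ else ⊥

/-- The lower end point of an element of the interval domain of `ℝ`; it is `-∞` for `⊥ = ℝ`. -/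
noncomputable def IntervalDomain.lower (I : IntervalDomain 1) : EReal :=
  ⨅ t ∈ I.carrier, ((t 0 : ℝ) : EReal)

/-- The upper end point of an element of the interval domain of `ℝ`; it is `+∞` for `⊥ = ℝ`. -/
noncomputable def IntervalDomain.upper (I : IntervalDomain 1) : EReal :=
  ⨆ t ∈ I.carrier, ((t 0 : ℝ) : EReal)

/-! ### Maximum value and maximum set -/

/-- The domain `Iℝⁿ ⇒ Iℝ` of Scott-continuous interval functions. -/
abbrev IntervalMap (n : ℕ) : Type := ScottMap (IntervalDomain n) (IntervalDomain 1)

/-- The supremum over `x ∈ X` of the lower end points of `f {x}`. -/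
noncomputable def maxLower {n : ℕ} (f : IntervalMap n) (X : Set (Fin n → ℝ)) : EReal :=
  ⨆ x ∈ X, (f.1 (IntervalDomain.point x)).lower

/-- The supremum over `x ∈ X` of the upper end points of `f {x}`. -/
noncomputable def maxUpper {n : ℕ} (f : IntervalMap n) (X : Set (Fin n → ℝ)) : EReal :=
  ⨆ x ∈ X, (f.1 (IntervalDomain.point x)).upper

/-- The maximum value `[maxLower f X, maxUpper f X]`; it is `⊥` if this is not a compact
interval of real numbers. -/
noncomputable def maxV {n : ℕ} (f : IntervalMap n) (X : Set (Fin n → ℝ)) : IntervalDomain 1 :=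
  IntervalDomain.ofSet
    {t | maxLower f X ≤ ((t 0 : ℝ) : EReal) ∧ ((t 0 : ℝ) : EReal) ≤ maxUpper f X}

/-- The maximum set: the points `x ∈ X` where `f {x}` meets `[maxLower f X, maxUpper f X]`.
Intervals are taken with their possibly infinite end points. -/
def maxSet {n : ℕ} (f : IntervalMap n) (X : Set (Fin n → ℝ)) : Set (Fin n → ℝ) :=
  {x | x ∈ X ∧ (Set.Icc (f.1 (IntervalDomain.point x)).lower
      (f.1 (IntervalDomain.point x)).upper ∩ Set.Icc (maxLower f X) (maxUpper f X)).Nonempty}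

/-- The maximum set as an element of the domain of compact sets. -/
noncomputable def maxS {n : ℕ} (f : IntervalMap n) (X : Set (Fin n → ℝ)) : CompactDomain n :=
  CompactDomain.ofSet (maxSet f X)

/-! ### Enumerated bases -/

/-- `X` is a nonempty finite union of hyperboxes with rational coordinates. -/
def IsRationalBoxUnion {n : ℕ} (X : Set (Fin n → ℝ)) : Prop :=
  ∃ S : Finset ((Fin n → ℚ) × (Fin n → ℚ)), S.Nonempty ∧ (∀ p ∈ S, p.1 ≤ p.2) ∧
    X = ⋃ p ∈ S, Set.Icc (fun i => (p.1 i : ℝ)) (fun i => (p.2 i : ℝ))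

/-- An enumeration of `ℚ`: the code of `((u, v), w)` is mapped to `(u - v) / (w + 1)`. -/
def ratOfNat (k : ℕ) : ℚ :=
  ((k.unpair.1.unpair.1 : ℚ) - (k.unpair.1.unpair.2 : ℚ)) / ((k.unpair.2 : ℚ) + 1)

/-- The `i`-th pair of rational numbers in the list coded by `k` (`(0, 0)` beyond its end). -/
def ratPair (k i : ℕ) : ℚ × ℚ :=
  let w := (Denumerable.ofNat (List (ℕ × ℕ)) k).getD i (0, 0)
  (ratOfNat w.1, ratOfNat w.2)

/-- An enumeration of the hyperboxes with rational coordinates; the `i`-th side is the interval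
spanned by the two components of `ratPair k i`. -/
def ratBox (n k : ℕ) : Set (Fin n → ℝ) :=
  Set.Icc (fun i => ((min (ratPair k i).1 (ratPair k i).2 : ℚ) : ℝ))
    (fun i => ((max (ratPair k i).1 (ratPair k i).2 : ℚ) : ℝ))

/-- Enumeration of the basis of the interval domain: `ℝⁿ` and all rational hyperboxes. -/
noncomputable def intervalBasis (n : ℕ) : ℕ → IntervalDomain n
  | 0 => ⊥
  | k + 1 => IntervalDomain.ofSet (ratBox n k)

/-- Enumeration of the basis of the domain of compact sets: `ℝⁿ` and all nonempty finite unions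
of rational hyperboxes. -/
noncomputable def compactBasis (n : ℕ) : ℕ → CompactDomain n
  | 0 => ⊥
  | k + 1 => CompactDomain.ofSet
      (⋃ j ∈ k.unpair.1 :: Denumerable.ofNat (List ℕ) k.unpair.2, ratBox n j)

/-- The single-step function with value `e` on `{x | d ≪ x}` and `⊥` elsewhere. -/
noncomputable def singleStep {D E : Type*} [PartialOrder D] [PartialOrder E] [OrderBot E]
    (d : D) (e : E) (x : D) : E :=
  open Classical in if WayBelow d x then e else ⊥

/-- The supremum of the single-step functions given by a list of pairs `(d, e)`, provided that they
have one (for bounded-complete domains: if and only if they are bounded), and `⊥` otherwise. -/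
noncomputable def stepFunction {D E : Type*} [PartialOrder D] [PartialOrder E] [OrderBot E]
    (L : List (D × E)) : ScottMap D E :=
  open Classical in
  if h : ∃ g : ScottMap D E, IsLUB {s | ∃ w ∈ L, s = singleStep w.1 w.2} g.1
  then h.choose else ⟨Function.const D ⊥, ScottContinuous.const ⊥⟩

/-- Enumeration of the rational step functions, the basis of `Iℝⁿ ⇒ Iℝ`. -/
noncomputable def stepBasis (n k : ℕ) : IntervalMap n :=
  stepFunction ((Denumerable.ofNat (List (ℕ × ℕ)) k).map
    fun w => (intervalBasis n w.1, intervalBasis 1 w.2))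

/-! ### Semidecidability toolkit -/

section Toolkit

variable {α β : Type*} [Primcodable α] [Primcodable β]

/-! The whole theorem reduces to open sets. A map between domains with enumerated bases is
computable in both senses once the preimages of the sets `{y | c i ≪ y}` are Scott-open and `c i ≪ f
(b j)` is recursively enumerable (`computable_of_openAt`): by openness, `c i ≪ f x` holds iff `c i ≪
f (b j)` for some `b j ≪ x`, and these `j` are listed by every name of `x`.

In the domains of boxes and of compact sets, `x ≪ y` means that `y` lies in the interior of `x`
(`IsSetDomain.wayBelow_iff`). For step functions, `≪` is tested on each step with nonempty interior
(`wayBelow_stepFunction_iff`), which makes the function space effectively given.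

Both functionals are governed by two conditions on `f`: its values are above `r` somewhere on `X`,
or below `r` everywhere on a compact set. The first is Scott-open directly, the second by
compactness. The maximum value lies in the open interval `(p, q)` iff `f` is somewhere above `p` and
everywhere below `q` (`maxV_subset_iff`). The maximum set lies in an open `U` iff `X ⊆ U` or some
rational `r` separates: `f` is somewhere on `X` above `r` and everywhere on `X \ U` below `r`
(`maxSet_subset_iff`). Upper end points are upper semicontinuous, hence attain their maximum on
compact sets; this supplies the separating `r` and the nonemptiness of the maximum set.

For a rational step function, the first condition is a finite check on rational boxes. The second
says that finitely many boxes are covered by the interior of a union of boxes together with finitely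
many open boxes. Enlarging the covered boxes and shrinking the open ones turns this into a cover of
closed rational boxes by closed rational boxes (`openCover_iff`), which is verified at finitely many
sample points (`exists_coverWitness_iff`). -/

theorem PrimrecPred.exists_mem {l : α → List β} {p : α → β → Prop} (hl : Primrec l)
    (hp : PrimrecRel p) : PrimrecPred fun a => ∃ b ∈ l a, p a b :=
  (PrimrecRel.exists_mem_list hp.swap).comp hl Primrec.id

theorem PrimrecPred.forall_mem {l : α → List β} {p : α → β → Prop} (hl : Primrec l)
    (hp : PrimrecRel p) : PrimrecPred fun a => ∀ b ∈ l a, p a b :=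
  (PrimrecRel.forall_mem_list hp.swap).comp hl Primrec.id

theorem PrimrecPred.imp {p q : α → Prop} (hp : PrimrecPred p) (hq : PrimrecPred q) :
    PrimrecPred fun a => p a → q a :=
  (hp.not.or hq).of_eq fun _ => imp_iff_not_or.symm

theorem primrecPred_const (p : Prop) : PrimrecPred fun _ : α => p :=
  ⟨fun _ => Classical.propDecidable p, Primrec.const _⟩

/-- Quantification over the words of length `n` with letters in a list. -/
theorem primrecPred_forall_words (n : ℕ) : ∀ {α : Type*} [Primcodable α] {S : α → List ℕ}
    {P : α → List ℕ → Prop}, Primrec S → PrimrecRel P →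
    PrimrecPred fun a => ∀ w : List ℕ, w.length = n → (∀ s ∈ w, s ∈ S a) → P a w := by
  induction n with
  | zero =>
    intro α _ S P hS hP
    refine (PrimrecRel.comp hP Primrec.id (Primrec.const [])).of_eq fun a => ?_
    simp
  | succ n ih =>
    intro α _ S P hS hP
    -- The first letter joins the parameter, so the induction hypothesis is needed at the type `α ×
    -- ℕ`; hence the quantifier over `α` inside the statement.
    have h := ih (α := α × ℕ) (S := fun x => S x.1) (P := fun x w => P x.1 (x.2 :: w))
      (hS.comp Primrec.fst)
      (PrimrecRel.comp hP (Primrec.fst.comp Primrec.fst)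
        (Primrec.list_cons.comp (Primrec.snd.comp Primrec.fst) Primrec.snd))
    refine (PrimrecPred.forall_mem (p := fun a s => ∀ w : List ℕ, w.length = n →
      (∀ s ∈ w, s ∈ S a) → P a (s :: w)) hS h).of_eq fun a => ?_
    constructor
    · rintro H (_ | ⟨s, w⟩) hw hs
      · simp at hw
      · exact H s (hs s (by simp)) w (by simpa using hw) fun t ht => hs t (by simp [ht])
    · intro H s hs w hw hws
      exact H (s :: w) (by simp [hw]) (by simpa using ⟨hs, hws⟩)

/-- `p` is the projection of a primitive recursive relation. -/
def IsSigmaOne (p : α → Prop) : Prop :=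
  ∃ R : α → ℕ → Prop, PrimrecRel R ∧ ∀ a, p a ↔ ∃ t, R a t

theorem PrimrecPred.isSigmaOne {p : α → Prop} (hp : PrimrecPred p) : IsSigmaOne p :=
  ⟨fun a _ => p a, hp.comp Primrec.fst, fun _ => by simp⟩

namespace IsSigmaOne

theorem of_eq {p q : α → Prop} (hp : IsSigmaOne p) (h : ∀ a, p a ↔ q a) : IsSigmaOne q :=
  (funext fun a => propext (h a) : p = q) ▸ hp

theorem comp {p : β → Prop} (hp : IsSigmaOne p) {f : α → β} (hf : Primrec f) :
    IsSigmaOne fun a => p (f a) := by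
  obtain ⟨R, hR, h⟩ := hp
  exact ⟨fun a t => R (f a) t, PrimrecRel.comp hR (hf.comp Primrec.fst) Primrec.snd,
    fun a => h (f a)⟩

theorem and {p q : α → Prop} (hp : IsSigmaOne p) (hq : IsSigmaOne q) :
    IsSigmaOne fun a => p a ∧ q a := by
  obtain ⟨R, hR, h⟩ := hp
  obtain ⟨Q, hQ, h'⟩ := hq
  refine ⟨fun a t => R a t.unpair.1 ∧ Q a t.unpair.2, ?_, fun a => ?_⟩
  · have hu := Primrec.unpair.comp (Primrec.snd (α := α) (β := ℕ))
    exact (PrimrecRel.comp hR Primrec.fst (Primrec.fst.comp hu)).and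
      (PrimrecRel.comp hQ Primrec.fst (Primrec.snd.comp hu))
  · simp only [h, h']
    constructor
    · rintro ⟨⟨t, ht⟩, ⟨s, hs⟩⟩
      exact ⟨Nat.pair t s, by simpa using ⟨ht, hs⟩⟩
    · rintro ⟨t, ht, hs⟩
      exact ⟨⟨_, ht⟩, ⟨_, hs⟩⟩

theorem or {p q : α → Prop} (hp : IsSigmaOne p) (hq : IsSigmaOne q) :
    IsSigmaOne fun a => p a ∨ q a := by
  obtain ⟨R, hR, h⟩ := hp
  obtain ⟨Q, hQ, h'⟩ := hq
  refine ⟨fun a t => R a t ∨ Q a t, PrimrecPred.or hR hQ, fun a => ?_⟩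
  simp only [h, h', exists_or]

theorem exists_nat {p : α → ℕ → Prop} (hp : IsSigmaOne fun x : α × ℕ => p x.1 x.2) :
    IsSigmaOne fun a => ∃ k, p a k := by
  obtain ⟨R, hR, h⟩ := hp
  refine ⟨fun a t => R (a, t.unpair.1) t.unpair.2, ?_, fun a => ?_⟩
  · have hu := Primrec.unpair.comp (Primrec.snd (α := α) (β := ℕ))
    exact PrimrecRel.comp hR (Primrec.fst.pair (Primrec.fst.comp hu)) (Primrec.snd.comp hu)
  · constructor
    · rintro ⟨k, hk⟩
      obtain ⟨t, ht⟩ := (h (a, k)).1 hk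
      exact ⟨Nat.pair k t, by simpa using ht⟩
    · rintro ⟨t, ht⟩
      exact ⟨_, (h (a, t.unpair.1)).2 ⟨_, ht⟩⟩

theorem rePred {p : α → Prop} (hp : IsSigmaOne p) : REPred p := by
  classical
  obtain ⟨R, hR, h⟩ := hp
  have hf : Computable₂ fun (a : α) (t : ℕ) => (if R a t then some () else none : Option Unit) :=
    (Primrec.ite hR (Primrec.const _) (Primrec.const _)).to_comp
  refine (Partrec.dom_re (Partrec.rfindOpt hf)).of_eq fun a => ?_
  rw [Nat.rfindOpt_dom, h]
  simp

end IsSigmaOne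

/-- Kleene's normal form: the witness `t` bounds the evaluation of a code for `p`, and bounded
evaluation is primitive recursive. -/
theorem REPred.isSigmaOne {p : α → Prop} (hp : REPred p) : IsSigmaOne p := by
  obtain ⟨c, hc⟩ := Nat.Partrec.Code.exists_code.1 hp
  refine ⟨fun a t => (Nat.Partrec.Code.evaln t c (Encodable.encode a)).isSome, ?_, fun a => ?_⟩
  · have h1 : Primrec fun x : α × ℕ =>
        Nat.Partrec.Code.evaln x.2 c (Encodable.encode x.1) :=
      Nat.Partrec.Code.primrec_evaln.comp
        ((Primrec.snd.pair (Primrec.const c)).pair (Primrec.encode.comp Primrec.fst))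
    exact ⟨fun _ => inferInstance, (Primrec.option_isSome.comp h1).of_eq fun _ => by simp⟩
  · have h2 : p a ↔ ((Nat.Partrec.Code.eval c) (Encodable.encode a)).Dom := by
      rw [hc]
      simp [Part.assert]
    rw [h2, Part.dom_iff_mem]
    simp only [Nat.Partrec.Code.evaln_complete, Option.isSome_iff_exists, Option.mem_def]
    exact exists_comm

end Toolkit

/-! ### Continuous and computable maps between domains -/

section Domains

variable {D E : Type*} [PartialOrder D] [PartialOrder E]

theorem WayBelow.le {x y : D} (h : WayBelow x y) : x ≤ y := by
  obtain ⟨d, rfl, hd⟩ := h {y} y (Set.singleton_nonempty y)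
    (directedOn_singleton y) isLUB_singleton le_rfl
  exact hd

theorem WayBelow.trans_le {x y z : D} (h : WayBelow x y) (hz : y ≤ z) : WayBelow x z :=
  fun S s hS hd hs hzs => h S s hS hd hs (hz.trans hzs)

theorem wayBelow_of_isBot {x : D} (h : IsBot x) (y : D) : WayBelow x y :=
  fun _ _ hS _ _ _ => hS.imp fun d hd => ⟨hd, h d⟩

/-- The predicate `P` defines a Scott-open set. -/
def ScottOpen (P : D → Prop) : Prop :=
  ∀ (S : Set D) (s : D), S.Nonempty → DirectedOn (· ≤ ·) S → IsLUB S s → (P s ↔ ∃ d ∈ S, P d)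

/-- The pair `{x, y}` is directed with supremum `y`. -/
theorem ScottOpen.mono {P : D → Prop} (h : ScottOpen P) {x y : D} (hxy : x ≤ y) (hx : P x) :
    P y :=
  (h {x, y} y (by simp) (directedOn_pair hxy)
    ⟨by simp [upperBounds, hxy], fun z hz => hz (by simp)⟩).2 ⟨x, by simp, hx⟩

/-- `{x | e ≪ f x}` is Scott-open. -/
def OpenAt (f : D → E) (e : E) : Prop := ScottOpen fun x => WayBelow e (f x)

theorem IsDomainBasis.le_of_forall {B : Set E} (hB : IsDomainBasis B) {x y : E}
    (h : ∀ e ∈ B, WayBelow e x → e ≤ y) : x ≤ y :=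
  (hB x).2.2.2 fun e he => h e he.1 he.2

/-- Inequalities in `E` can be tested on the basis elements way below the left side, so it suffices
to know the preimages of the sets `{y | e ≪ y}`. -/
theorem scottContinuous_of_openAt {B : Set E} (hB : IsDomainBasis B) {f : D → E}
    (h : ∀ e ∈ B, OpenAt f e) : ScottContinuous f := by
  have hm : Monotone f := fun x y hxy =>
    hB.le_of_forall fun e he hx => (ScottOpen.mono (h e he) hxy hx).le
  intro S hS hd s hs
  refine ⟨?_, fun y hy => hB.le_of_forall fun e he hx => ?_⟩
  · rintro _ ⟨d, hdS, rfl⟩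
    exact hm (hs.1 hdS)
  · obtain ⟨d, hdS, hed⟩ := (h e he S s hS hd hs).1 hx
    exact hed.le.trans (hy ⟨d, hdS, rfl⟩)

/-- The word function that, for every `s` below the length of the input word, decodes `s` as a
triple `(i, m, t)` and writes `i` if `R (i, p m) t` holds for the `m`-th input letter `p m`. -/
noncomputable def enumerationWord (R : ℕ × ℕ → ℕ → Prop) (u : List ℕ) : List ℕ :=
  open Classical in
  (List.range u.length).map fun s =>
    if R (s.unpair.1, u.getD s.unpair.2.unpair.1 0) s.unpair.2.unpair.2 then s.unpair.1 else 0

theorem primrec_enumerationWord {R : ℕ × ℕ → ℕ → Prop} (hR : PrimrecRel R) :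
    Primrec (enumerationWord R) := by
  classical
  have hu : Primrec fun x : List ℕ × ℕ => x.2.unpair := Primrec.unpair.comp Primrec.snd
  have hv : Primrec fun x : List ℕ × ℕ => x.2.unpair.2.unpair :=
    Primrec.unpair.comp (Primrec.snd.comp hu)
  have h1 : Primrec fun x : List ℕ × ℕ => x.1.getD x.2.unpair.2.unpair.1 0 :=
    (Primrec.list_getD 0).comp Primrec.fst (Primrec.fst.comp hv)
  refine Primrec.list_map (Primrec.list_range.comp Primrec.list_length)
    ((Primrec.ite (PrimrecRel.comp hR ((Primrec.fst.comp hu).pair h1) (Primrec.snd.comp hv))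
      (Primrec.fst.comp hu) (Primrec.const 0)).of_eq fun x => ?_)
  congr

theorem seqPrefix_length (p : ℕ → ℕ) (k : ℕ) : (seqPrefix p k).length = k := by
  simp [seqPrefix]

theorem seqPrefix_getD (p : ℕ → ℕ) {k m : ℕ} (h : m < k) : (seqPrefix p k).getD m 0 = p m := by
  simp [seqPrefix, List.getD, h]

/-- The position consulted by the `s`-th output letter has already been read when that letter is
written, so the default of `getD` never occurs and longer inputs only extend the output. -/
theorem unpair_unpair_le (s : ℕ) : s.unpair.2.unpair.1 ≤ s :=
  (Nat.unpair_left_le _).trans (Nat.unpair_right_le _)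

theorem enumerationWord_prefix (R : ℕ × ℕ → ℕ → Prop) {u v : List ℕ} (h : u <+: v) :
    enumerationWord R u <+: enumerationWord R v := by
  classical
  obtain ⟨w, rfl⟩ := h
  rw [List.prefix_iff_eq_take]
  refine List.ext_getElem ?_ fun s h1 h2 => ?_
  · simp [enumerationWord]
  · have hs : s < u.length := by simpa [enumerationWord] using h1
    have := (unpair_unpair_le s).trans_lt hs
    simp [enumerationWord, List.getD, List.getElem?_append_left this]

/-- A map with Scott-open preimages of the sets `{y | c i ≪ y}` and a recursively enumerable graph
is computable in both senses. -/
theorem computable_of_openAt {b : ℕ → D} {c : ℕ → E} {f : D → E}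
    (hb : IsDomainBasis (Set.range b)) (hc : IsDomainBasis (Set.range c)) (hbot : IsBot (c 0))
    (hf : ∀ i, OpenAt f (c i)) (hre : REPred fun p : ℕ × ℕ => WayBelow (c p.1) (f (b p.2))) :
    IsTTEComputable b c f ∧ IsEffectiveMap b c f := by
  classical
  refine ⟨?_, ⟨scottContinuous_of_openAt hc (by rintro _ ⟨i, rfl⟩; exact hf i), hre⟩⟩
  obtain ⟨R, hR, h⟩ := hre.isSigmaOne
  refine ⟨enumerationWord R, (primrec_enumerationWord hR).to_comp,
    fun u v => enumerationWord_prefix R, fun x p hp => ?_⟩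
  refine ⟨fun s => if R (s.unpair.1, p s.unpair.2.unpair.1) s.unpair.2.unpair.2
    then s.unpair.1 else 0, ?_, fun m => ⟨m, ?_⟩⟩
  -- Openness is applied to the directed set of basis elements way below `x`, whose indices are
  -- exactly the letters of the name.
  · have key : ∀ i, WayBelow (c i) (f x) ↔ ∃ m t, R (i, p m) t := by
      intro i
      refine (hf i _ x (hb x).1 (hb x).2.1 (hb x).2.2).trans ?_
      constructor
      · rintro ⟨_, ⟨⟨j, rfl⟩, hj⟩, hi⟩
        obtain ⟨m, rfl⟩ : j ∈ Set.range p := hp ▸ hj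
        exact ⟨m, (h (i, p m)).1 hi⟩
      · rintro ⟨m, t, ht⟩
        have hm : p m ∈ {j | WayBelow (b j) x} := hp ▸ Set.mem_range_self m
        exact ⟨b (p m), ⟨⟨p m, rfl⟩, hm⟩, (h (i, p m)).2 ⟨t, ht⟩⟩
    ext i
    rw [Set.mem_ofPred_eq, key]
    constructor
    · rintro ⟨s, hs⟩
      dsimp only at hs
      split_ifs at hs with hR'
      · exact hs ▸ ⟨_, _, hR'⟩
      -- The filler letter `0` is always a correct output, because `c 0` is the bottom element.
      · exact hs ▸ (key 0).1 (wayBelow_of_isBot hbot _)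
    · rintro ⟨m, t, ht⟩
      exact ⟨Nat.pair i (Nat.pair m t), by simp [ht]⟩
  · have of_eq : ∀ {u v : List ℕ}, u = v → u <+: v := fun h => h ▸ List.prefix_refl _
    refine of_eq ?_
    unfold enumerationWord
    rw [seqPrefix_length]
    refine List.map_congr_left fun s hs => ?_
    rw [seqPrefix_getD p ((unpair_unpair_le s).trans_lt (List.mem_range.1 hs))]

end Domains

/-! ### Domains of compact sets -/

/-- `c` represents `D` as a set of nonempty compact subsets of `X`, together possibly with `X`,
ordered by reverse inclusion, closed under filtered intersections; the sets represented by `B`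
approximate all others from above. -/
structure IsSetDomain {D X : Type*} [PartialOrder D] [TopologicalSpace X] (c : D → Set X)
    (B : Set D) : Prop where
  le_iff : ∀ x y, x ≤ y ↔ c y ⊆ c x
  compact : ∀ x, c x = Set.univ ∨ ((c x).Nonempty ∧ IsCompact (c x))
  inter : ∀ S : Set D, S.Nonempty → DirectedOn (· ≤ ·) S → ∃ s, c s = ⋂ d ∈ S, c d
  approx : ∀ y U, IsOpen U → c y ⊆ U → ∃ b ∈ B, c y ⊆ interior (c b) ∧ c b ⊆ U

section SetDomain

variable {D X : Type*} [PartialOrder D] [TopologicalSpace X] {c : D → Set X} {B : Set D}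

namespace IsSetDomain

theorem isLUB_of_eq (h : IsSetDomain c B) {S : Set D} {s : D}
    (hs : c s = ⋂ d ∈ S, c d) : IsLUB S s := by
  constructor
  · intro d hd
    exact (h.le_iff _ _).2 (hs ▸ Set.biInter_subset_of_mem hd)
  · intro y hy
    rw [h.le_iff, hs]
    exact Set.subset_iInter₂ fun d hd => (h.le_iff _ _).1 (hy hd)

theorem isLUB_iff (h : IsSetDomain c B) {S : Set D} {s : D} (hS : S.Nonempty)
    (hd : DirectedOn (· ≤ ·) S) :
    IsLUB S s ↔ c s = ⋂ d ∈ S, c d := by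
  refine ⟨fun hs => ?_, h.isLUB_of_eq⟩
  obtain ⟨t, ht⟩ := h.inter S hS hd
  rw [hs.unique (h.isLUB_of_eq ht), ht]

theorem isDCPO (h : IsSetDomain c B) : IsDCPO D := fun S hS hd =>
  (h.inter S hS hd).imp fun _ => h.isLUB_of_eq

end IsSetDomain

variable [T2Space X]

/-- Compactness of filtered families: unless all members are the whole space, one may pass to those
above a proper one, which are compact. Only two properties of `c` are assumed, since the lemma also
serves to prove closure under filtered intersections. -/
theorem exists_subset_of_directedOn (hle : ∀ x y, x ≤ y ↔ c y ⊆ c x)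
    (hc : ∀ x, c x = Set.univ ∨ ((c x).Nonempty ∧ IsCompact (c x)))
    {S : Set D} (hS : S.Nonempty) (hd : DirectedOn (· ≤ ·) S) {U : Set X} (hU : IsOpen U)
    (h : ⋂ d ∈ S, c d ⊆ U) : ∃ d ∈ S, c d ⊆ U := by
  by_cases hcpt : ∀ d ∈ S, c d = Set.univ
  · obtain ⟨d, hdS⟩ := hS
    refine ⟨d, hdS, fun x _ => h ?_⟩
    simp only [Set.mem_iInter]
    intro e he
    simp [hcpt e he]
  push Not at hcpt
  obtain ⟨d₀, hd₀, hne⟩ := hcpt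
  have h0 := ((hc d₀).resolve_left hne).2
  have hcomp : ∀ d, d₀ ≤ d → IsCompact (c d) := fun d hd => by
    rcases hc d with h | h
    · exact absurd (Set.univ_subset_iff.1 (h ▸ (hle _ _).1 hd)) hne
    · exact h.2
  have : Nonempty {d // d ∈ S ∧ d₀ ≤ d} := ⟨⟨d₀, hd₀, le_rfl⟩⟩
  have hdir : Directed (· ⊇ ·) fun d : {d // d ∈ S ∧ d₀ ≤ d} => c d.1 := by
    rintro ⟨x, hx⟩ ⟨y, hy⟩
    obtain ⟨z, hz, hxz, hyz⟩ := hd x hx.1 y hy.1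
    exact ⟨⟨z, hz, hx.2.trans hxz⟩, (hle _ _).1 hxz, (hle _ _).1 hyz⟩
  obtain ⟨⟨d, hdS⟩, hdU⟩ := exists_subset_nhds_of_isCompact' hdir (fun d => hcomp _ d.2.2)
    (fun d => (hcomp _ d.2.2).isClosed) (U := U) (fun x hx => hU.mem_nhds (h (by
      simp only [Set.mem_iInter] at hx ⊢
      intro d hdS
      obtain ⟨z, hz, hxz, hyz⟩ := hd d hdS d₀ hd₀
      exact (hle _ _).1 hxz (hx ⟨z, hz, hyz⟩))))
  exact ⟨d, hdS.1, hdU⟩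

/-- If the intersection were empty, `exists_subset_of_directedOn` with `U = ∅` would produce an
empty member. -/
theorem iInter_eq_univ_or_compact (hle : ∀ x y, x ≤ y ↔ c y ⊆ c x)
    (hc : ∀ x, c x = Set.univ ∨ ((c x).Nonempty ∧ IsCompact (c x)))
    {S : Set D} (hS : S.Nonempty) (hd : DirectedOn (· ≤ ·) S) :
    (⋂ d ∈ S, c d) = Set.univ ∨ ((⋂ d ∈ S, c d).Nonempty ∧ IsCompact (⋂ d ∈ S, c d)) := by
  by_cases hcpt : ∀ d ∈ S, c d = Set.univ
  · left
    simp +contextual [hcpt]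
  right
  push Not at hcpt
  obtain ⟨d₀, hd₀, hne⟩ := hcpt
  have h0 := (hc d₀).resolve_left hne
  constructor
  · rw [Set.nonempty_iff_ne_empty]
    intro he
    obtain ⟨d, hdS, hde⟩ := exists_subset_of_directedOn hle hc hS hd isOpen_empty he.le
    rcases hc d with h | h
    · obtain ⟨x, _⟩ := h0.1
      exact hde (h ▸ Set.mem_univ x)
    · exact h.1.ne_empty (Set.subset_empty_iff.1 hde)
  · refine h0.2.of_isClosed_subset (isClosed_biInter fun d _ => ?_)
      (Set.biInter_subset_of_mem hd₀)
    rcases hc d with h | h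
    · exact h ▸ isClosed_univ
    · exact h.2.isClosed

namespace IsSetDomain

theorem isClosed (h : IsSetDomain c B) (x : D) : IsClosed (c x) := by
  rcases h.compact x with h | h
  · exact h ▸ isClosed_univ
  · exact h.2.isClosed

theorem exists_subset (h : IsSetDomain c B) {S : Set D} {s : D} (hS : S.Nonempty)
    (hd : DirectedOn (· ≤ ·) S) (hs : IsLUB S s) {U : Set X} (hU : IsOpen U) (hsU : c s ⊆ U) : ∃ d ∈ S, c d ⊆ U :=
  exists_subset_of_directedOn h.le_iff h.compact hS hd hU (((h.isLUB_iff hS hd).1 hs) ▸ hsU)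

/-- Points are closed, so a set is the intersection of the open sets containing it. -/
theorem subset_of_forall_open (_ : IsSetDomain c B) {x : D} {A : Set X}
    (hA : ∀ U, IsOpen U → c x ⊆ U → A ⊆ U) : A ⊆ c x := by
  intro a ha
  by_contra hax
  exact hA {a}ᶜ isClosed_singleton.isOpen_compl
    (fun y hy hya => hax (hya ▸ hy)) ha rfl

/-- This is the basis property with interiors in place of `≪`; the description of `≪` in
`wayBelow_iff` is deduced from it. -/
theorem approximants (h : IsSetDomain c B) (x : D) : {b | b ∈ B ∧ c x ⊆ interior (c b)}.Nonempty ∧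
    DirectedOn (· ≤ ·) {b | b ∈ B ∧ c x ⊆ interior (c b)} ∧
    IsLUB {b | b ∈ B ∧ c x ⊆ interior (c b)} x := by
  refine ⟨?_, ?_, ?_⟩
  · obtain ⟨b, hb, hxb, -⟩ := h.approx x Set.univ isOpen_univ (Set.subset_univ _)
    exact ⟨b, hb, hxb⟩
  · rintro b ⟨-, hb⟩ b' ⟨-, hb'⟩
    obtain ⟨e, he, hxe, hbe⟩ := h.approx x _ (isOpen_interior.inter isOpen_interior)
      (Set.subset_inter hb hb')
    exact ⟨e, ⟨he, hxe⟩, (h.le_iff _ _).2 (hbe.trans (Set.inter_subset_left.trans interior_subset)),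
      (h.le_iff _ _).2 (hbe.trans (Set.inter_subset_right.trans interior_subset))⟩
  · refine h.isLUB_of_eq (Set.Subset.antisymm
      (Set.subset_iInter₂ fun b hb => hb.2.trans interior_subset)
      (h.subset_of_forall_open fun U hU hxU => ?_))
    obtain ⟨b, hb, hxb, hbU⟩ := h.approx x U hU hxU
    exact (Set.biInter_subset_of_mem (show b ∈ {b | b ∈ B ∧ c x ⊆ interior (c b)} from
      ⟨hb, hxb⟩)).trans hbU

/-- Forwards, `≪` is tested on the directed set of approximants of `y`; backwards, the open set
`interior (c x)` must contain a member of every directed set whose supremum is above `y`, by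
compactness. -/
theorem wayBelow_iff (h : IsSetDomain c B) {x y : D} : WayBelow x y ↔ c y ⊆ interior (c x) := by
  constructor
  · intro hxy
    obtain ⟨h1, h2, h3⟩ := h.approximants y
    obtain ⟨b, ⟨-, hb⟩, hxb⟩ := hxy _ y h1 h2 h3 le_rfl
    exact hb.trans (interior_mono ((h.le_iff _ _).1 hxb))
  · intro hxy S s hS hd hs hys
    obtain ⟨d, hdS, hd⟩ := h.exists_subset hS hd hs isOpen_interior
      (((h.le_iff _ _).1 hys).trans hxy)
    exact ⟨d, hdS, (h.le_iff _ _).2 (hd.trans interior_subset)⟩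

theorem isDomainBasis (h : IsSetDomain c B) : IsDomainBasis B := fun x => by
  simpa only [h.wayBelow_iff] using h.approximants x

theorem exists_wayBelow (h : IsSetDomain c B) (x : D) {U : Set X} (hU : IsOpen U) (hx : c x ⊆ U) :
    ∃ b ∈ B, WayBelow b x ∧ c b ⊆ U := by
  simpa only [h.wayBelow_iff] using h.approx x U hU hx

/-- The neighbourhood criterion of Scott continuity. -/
theorem scottContinuous_iff (h : IsSetDomain c B) {E Y : Type*} [PartialOrder E] [TopologicalSpace Y] [T2Space Y]
    {c' : E → Set Y} {B' : Set E} (h' : IsSetDomain c' B') {f : D → E} :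
    ScottContinuous f ↔ Monotone f ∧ ∀ x U, IsOpen U → c' (f x) ⊆ U →
      ∃ d ∈ B, WayBelow d x ∧ c' (f d) ⊆ U := by
  constructor
  · refine fun hf => ⟨hf.monotone, fun x U hU hxU => ?_⟩
    obtain ⟨h1, h2, h3⟩ := h.isDomainBasis x
    obtain ⟨_, ⟨d, hd, rfl⟩, hdU⟩ := h'.exists_subset (h1.image f)
      (directedOn_image.2 (h2.mono' fun _ _ _ _ hab => hf.monotone hab)) (hf h1 h2 h3) hU hxU
    exact ⟨d, hd.1, hd.2, hdU⟩
  · rintro ⟨hm, hf⟩ S hS hd s hs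
    refine ⟨?_, fun y hy => ?_⟩
    · rintro _ ⟨d, hdS, rfl⟩
      exact hm (hs.1 hdS)
    · rw [h'.le_iff]
      refine h'.subset_of_forall_open fun U hU hsU => ?_
      obtain ⟨d, -, hds, hdU⟩ := hf s U hU hsU
      obtain ⟨t, htS, hdt⟩ := hds S s hS hd hs le_rfl
      exact ((h'.le_iff _ _).1 ((hm hdt).trans (hy ⟨t, htS, rfl⟩))).trans hdU

end IsSetDomain

end SetDomain

/-! ### Hyperboxes with rational coordinates -/

section Boxes

variable {n : ℕ}

theorem mem_interior_Icc_pi {a b x : Fin n → ℝ} :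
    x ∈ interior (Set.Icc a b) ↔ ∀ i, a i < x i ∧ x i < b i := by
  rw [← Set.pi_univ_Icc, interior_pi_set Set.finite_univ]
  simp [Set.mem_pi]

theorem mem_Icc_pi {a b x : Fin n → ℝ} : x ∈ Set.Icc a b ↔ ∀ i, a i ≤ x i ∧ x i ≤ b i := by
  rw [Set.mem_Icc, Pi.le_def, Pi.le_def, forall_and]

theorem ratOfNat_surjective : Function.Surjective ratOfNat := by
  intro q
  -- The numerator is coded by its positive and negative parts; the denominator is stored minus one.
  refine ⟨Nat.pair (Nat.pair q.num.toNat (-q.num).toNat) (q.den - 1), ?_⟩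
  have h1 : ((q.den - 1 : ℕ) : ℚ) + 1 = q.den := by
    have := q.den_pos
    rw [← Nat.cast_succ, Nat.succ_eq_add_one, Nat.sub_add_cancel this]
  have h2 : ((q.num.toNat : ℚ)) - ((-q.num).toNat : ℚ) = q.num := by
    have : ((q.num.toNat : ℤ)) - ((-q.num).toNat : ℤ) = q.num := by omega
    exact_mod_cast this
  simp only [ratOfNat, Nat.unpair_pair, h1, h2, Rat.num_div_den]

theorem exists_ratBox_eq {q r : Fin n → ℚ} (h : q ≤ r) :
    ∃ k, ratBox n k = Set.Icc (fun i => (q i : ℝ)) (fun i => (r i : ℝ)) := by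
  choose g hg using ratOfNat_surjective
  refine ⟨Encodable.encode (List.ofFn fun i => (g (q i), g (r i))), ?_⟩
  have key : ∀ i : Fin n, ratPair (Encodable.encode (List.ofFn fun i => (g (q i), g (r i)))) i
      = (q i, r i) := by
    intro i
    simp [ratPair, hg, List.getD]
  simp [ratBox, key, min_eq_left (h _), max_eq_right (h _)]

theorem ratBox_eq_Icc (k : ℕ) : ∃ q r : Fin n → ℚ, q ≤ r ∧
    ratBox n k = Set.Icc (fun i => (q i : ℝ)) (fun i => (r i : ℝ)) :=
  ⟨_, _, fun _ => min_le_max, rfl⟩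

theorem isHyperbox_ratBox (k : ℕ) : IsHyperbox (ratBox n k) := by
  obtain ⟨q, r, h, h'⟩ := ratBox_eq_Icc (n := n) k
  exact ⟨_, _, fun i => Rat.cast_le.2 (h i), h'⟩

theorem IsHyperbox.nonempty {C : Set (Fin n → ℝ)} (h : IsHyperbox C) : C.Nonempty := by
  obtain ⟨a, b, hab, rfl⟩ := h
  exact Set.nonempty_Icc.2 hab

theorem IsHyperbox.isCompact {C : Set (Fin n → ℝ)} (h : IsHyperbox C) : IsCompact C := by
  obtain ⟨a, b, hab, rfl⟩ := h
  exact isCompact_Icc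

theorem exists_ratBox_between {C U : Set (Fin n → ℝ)} (hC : IsHyperbox C) (hU : IsOpen U)
    (h : C ⊆ U) : ∃ k, C ⊆ interior (ratBox n k) ∧ ratBox n k ⊆ U := by
  obtain ⟨a, b, hab, rfl⟩ := hC
  -- The rational box is chosen with each side extending the given one by less than `δ` in both
  -- directions, hence it stays within the closed `δ`-thickening for the sup metric.
  obtain ⟨δ, hδ, hδU⟩ := isCompact_Icc.exists_cthickening_subset_open hU h
  choose q hq using fun i => exists_rat_btwn (sub_lt_self (a i) hδ)
  choose r hr using fun i => exists_rat_btwn (lt_add_of_pos_right (b i) hδ)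
  have hqr : q ≤ r := fun i => by
    have := hab i
    exact_mod_cast ((hq i).2.le.trans this).trans (hr i).1.le
  obtain ⟨k, hk⟩ := exists_ratBox_eq hqr
  refine ⟨k, fun x hx => ?_, fun x hx => hδU ?_⟩
  · rw [mem_Icc_pi] at hx
    rw [hk, mem_interior_Icc_pi]
    exact fun i => ⟨(hq i).2.trans_le (hx i).1, (hx i).2.trans_lt (hr i).1⟩
  · rw [hk, mem_Icc_pi] at hx
    -- Clamping each coordinate of `x` to the original side gives a point of the box within distance
    -- `δ`.
    refine Metric.mem_cthickening_of_dist_le x (fun i => max (a i) (min (b i) (x i))) δ _ ?_ ?_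
    · rw [mem_Icc_pi]
      exact fun i => ⟨le_max_left _ _, max_le (hab i) (min_le_left _ _)⟩
    · rw [dist_pi_le_iff hδ.le]
      intro i
      have h1 := hq i
      have h2 := hr i
      have h3 := hx i
      have h4 := hab i
      rw [Real.dist_eq, abs_le]
      rcases le_total (b i) (x i) with h5 | h5
      · rw [min_eq_left h5, max_eq_right h4]
        constructor <;> linarith
      · rw [min_eq_right h5]
        rcases le_total (a i) (x i) with h6 | h6
        · rw [max_eq_right h6]
          constructor <;> linarith
        · rw [max_eq_left h6]
          constructor <;> linarith

theorem isHyperbox_singleton (x : Fin n → ℝ) : IsHyperbox {x} :=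
  ⟨x, x, le_rfl, (Set.Icc_self x).symm⟩

/-! ### The interval domain -/

theorem IntervalDomain.carrier_ofSet {C : Set (Fin n → ℝ)} (h : IsHyperbox C) :
    (IntervalDomain.ofSet C).carrier = C := by
  simp [IntervalDomain.ofSet, h]

@[simp] theorem IntervalDomain.carrier_bot : (⊥ : IntervalDomain n).carrier = Set.univ := rfl

@[simp] theorem CompactDomain.carrier_bot : (⊥ : CompactDomain n).carrier = Set.univ := rfl

theorem intervalBasis_zero : intervalBasis n 0 = ⊥ := rfl

theorem carrier_intervalBasis_succ (k : ℕ) :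
    (intervalBasis n (k + 1)).carrier = ratBox n k :=
  IntervalDomain.carrier_ofSet (isHyperbox_ratBox k)

/-- A family of boxes with a common point has a box as its intersection. -/
theorem IntervalDomain.exists_carrier_eq_iInter {S : Set (IntervalDomain n)}
    (h : (⋂ d ∈ S, d.carrier).Nonempty) : ∃ s : IntervalDomain n, s.carrier = ⋂ d ∈ S, d.carrier := by
  by_cases hu : ∀ d ∈ S, d.carrier = Set.univ
  · exact ⟨⊥, by simp +contextual [hu]⟩
  push Not at hu
  obtain ⟨d₀, hd₀, hne⟩ := hu
  obtain ⟨x, hx⟩ := h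
  let T : Set ((Fin n → ℝ) × (Fin n → ℝ)) := {p | ∃ d ∈ S, d.carrier = Set.Icc p.1 p.2}
  have hT : ∀ p ∈ T, p.1 ≤ x ∧ x ≤ p.2 := by
    rintro p ⟨d, hd, hp⟩
    have : x ∈ d.carrier := Set.biInter_subset_of_mem hd hx
    rwa [hp] at this
  obtain ⟨a₀, b₀, -, h₀⟩ := (d₀.isBox.resolve_left hne)
  have h₀T : (a₀, b₀) ∈ T := ⟨d₀, hd₀, h₀⟩
  -- Coordinatewise, the lower ends are bounded above by the common point `x`, and there is at least
  -- one of them because of `d₀`.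
  obtain ⟨a, ha⟩ : ∃ a, IsLUB (Prod.fst '' T) a := by
    refine ⟨fun i => sSup (Function.eval i '' (Prod.fst '' T)), ?_⟩
    refine isLUB_pi.2 fun i => isLUB_csSup ⟨a₀ i, a₀, ⟨_, h₀T, rfl⟩, rfl⟩ ⟨x i, ?_⟩
    rintro _ ⟨_, ⟨p, hp, rfl⟩, rfl⟩
    exact (hT p hp).1 i
  obtain ⟨b, hb⟩ : ∃ b, IsGLB (Prod.snd '' T) b := by
    refine ⟨fun i => sInf (Function.eval i '' (Prod.snd '' T)), ?_⟩
    refine isGLB_pi.2 fun i => isGLB_csInf ⟨b₀ i, b₀, ⟨_, h₀T, rfl⟩, rfl⟩ ⟨x i, ?_⟩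
    rintro _ ⟨_, ⟨p, hp, rfl⟩, rfl⟩
    exact (hT p hp).2 i
  have key : (⋂ d ∈ S, d.carrier) = Set.Icc a b := by
    ext y
    rw [Set.mem_Icc, isLUB_le_iff ha, le_isGLB_iff hb]
    simp only [Set.mem_iInter]
    constructor
    · intro hy
      constructor
      · rintro _ ⟨p, ⟨d, hd, hp⟩, rfl⟩
        exact (hp ▸ hy d hd : y ∈ Set.Icc p.1 p.2).1
      · rintro _ ⟨p, ⟨d, hd, hp⟩, rfl⟩
        exact (hp ▸ hy d hd : y ∈ Set.Icc p.1 p.2).2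
    · rintro ⟨h1, h2⟩ d hd
      rcases d.isBox with h | ⟨a, b, -, h⟩
      · simp [h]
      · have : (a, b) ∈ T := ⟨d, hd, h⟩
        rw [h]
        exact ⟨h1 ⟨_, this, rfl⟩, h2 ⟨_, this, rfl⟩⟩
  refine ⟨⟨_, Or.inr ⟨a, b, ?_, key⟩⟩, rfl⟩
  rw [key] at hx
  exact hx.1.trans hx.2

theorem IntervalDomain.eq_univ_or_compact (x : IntervalDomain n) :
    x.carrier = Set.univ ∨ (x.carrier.Nonempty ∧ IsCompact x.carrier) :=
  x.isBox.imp id fun h => ⟨h.nonempty, h.isCompact⟩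

theorem isSetDomain_interval : IsSetDomain (IntervalDomain.carrier (n := n))
    (Set.range (intervalBasis n)) where
  le_iff _ _ := Iff.rfl
  compact := IntervalDomain.eq_univ_or_compact
  inter S hS hd := by
    rcases iInter_eq_univ_or_compact (fun _ _ => Iff.rfl) IntervalDomain.eq_univ_or_compact hS hd
      with h | h
    · exact ⟨⊥, h.symm⟩
    · exact IntervalDomain.exists_carrier_eq_iInter h.1
  approx y U hU hyU := by
    rcases y.isBox with h | h
    · exact ⟨_, ⟨0, rfl⟩, by simp [intervalBasis_zero], by
        rw [h] at hyU; simpa [intervalBasis_zero] using hyU⟩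
    · obtain ⟨k, h1, h2⟩ := exists_ratBox_between h hU hyU
      exact ⟨_, ⟨k + 1, rfl⟩, by rwa [carrier_intervalBasis_succ],
        by rwa [carrier_intervalBasis_succ]⟩

/-! ### The domain of compact sets -/

theorem CompactDomain.carrier_ofSet {C : Set (Fin n → ℝ)} (h : C.Nonempty ∧ IsCompact C) :
    (CompactDomain.ofSet C).carrier = C := by
  simp [CompactDomain.ofSet, h]

theorem compactBasis_zero : compactBasis n 0 = ⊥ := rfl

/-- The nonempty list of box codes given by the code of a finite union of boxes. -/
def boxList (k : ℕ) : List ℕ := k.unpair.1 :: Denumerable.ofNat (List ℕ) k.unpair.2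

theorem isCompact_ratBoxes (l : List ℕ) : IsCompact (⋃ j ∈ l, ratBox n j) :=
  (List.finite_toSet l).isCompact_biUnion fun j _ => (isHyperbox_ratBox j).isCompact

theorem carrier_compactBasis_succ (k : ℕ) :
    (compactBasis n (k + 1)).carrier = ⋃ j ∈ boxList k, ratBox n j := by
  refine CompactDomain.carrier_ofSet ⟨?_, isCompact_ratBoxes (boxList k)⟩
  obtain ⟨x, hx⟩ := (isHyperbox_ratBox (n := n) k.unpair.1).nonempty
  exact ⟨x, Set.mem_biUnion (List.mem_cons_self) hx⟩

theorem exists_boxList_eq {l : List ℕ} (hl : l ≠ []) : ∃ k, boxList k = l := by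
  obtain ⟨j, l, rfl⟩ := List.exists_cons_of_ne_nil hl
  exact ⟨Nat.pair j (Encodable.encode l), by simp [boxList]⟩

/-- A compact set covered by open sets has a finite cover by the interiors of boxes that are
contained in these open sets. -/
theorem exists_ratBoxes_between {K : Set (Fin n → ℝ)} (hK : IsCompact K)
    {𝒰 : Set (Set (Fin n → ℝ))} (hU : ∀ U ∈ 𝒰, IsOpen U) (h : ∀ x ∈ K, ∃ U ∈ 𝒰, x ∈ U) :
    ∃ l : List ℕ, (∀ x ∈ K, ∃ j ∈ l, x ∈ interior (ratBox n j)) ∧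
      ∀ j ∈ l, ∃ U ∈ 𝒰, ratBox n j ⊆ U := by
  choose! U hUm hxU using h
  choose! k hk hkU using fun x (hx : x ∈ K) =>
    exists_ratBox_between (isHyperbox_singleton x) (hU _ (hUm x hx))
      (Set.singleton_subset_iff.2 (hxU x hx))
  obtain ⟨t, htK, ht⟩ := hK.elim_nhds_subcover (fun x => interior (ratBox n (k x)))
    fun x hx => isOpen_interior.mem_nhds (Set.singleton_subset_iff.1 (hk x hx))
  refine ⟨t.toList.map k, fun x hx => ?_, fun j hj => ?_⟩
  · obtain ⟨y, hy, hxy⟩ := Set.mem_iUnion₂.1 (ht hx)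
    exact ⟨k y, List.mem_map_of_mem (Finset.mem_toList.2 hy), hxy⟩
  · obtain ⟨y, hy, rfl⟩ := List.mem_map.1 hj
    have hyK := htK y (Finset.mem_toList.1 hy)
    exact ⟨U y, hUm y hyK, hkU y hyK⟩

theorem isSetDomain_compact : IsSetDomain (CompactDomain.carrier (n := n))
    (Set.range (compactBasis n)) where
  le_iff _ _ := Iff.rfl
  compact x := x.isCompact
  inter S hS hd :=
    ⟨⟨_, iInter_eq_univ_or_compact (fun _ _ => Iff.rfl) (fun x => x.isCompact) hS hd⟩, rfl⟩
  approx y U hU hyU := by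
    rcases y.isCompact with h | h
    · exact ⟨_, ⟨0, rfl⟩, by simp [compactBasis_zero], by
        rw [h] at hyU; simpa [compactBasis_zero] using hyU⟩
    · obtain ⟨l, h1, h2⟩ := exists_ratBoxes_between h.2 (𝒰 := {U}) (by simpa using hU)
        fun x hx => ⟨U, rfl, hyU hx⟩
      obtain ⟨x, hx⟩ := h.1
      obtain ⟨k, rfl⟩ := exists_boxList_eq (l := l) (by
        rintro rfl
        obtain ⟨j, hj, -⟩ := h1 x hx
        simp at hj)
      refine ⟨_, ⟨k + 1, rfl⟩, fun y hy => ?_, ?_⟩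
      · obtain ⟨j, hj, hyj⟩ := h1 y hy
        rw [carrier_compactBasis_succ]
        exact interior_mono (Set.subset_biUnion_of_mem (u := fun j => ratBox n j) hj) hyj
      · rw [carrier_compactBasis_succ]
        exact Set.iUnion₂_subset fun j hj => by simpa using h2 j hj

end Boxes

/-! ### The domain of Scott-continuous interval functions -/

section FunctionSpace

variable {n : ℕ}

theorem wayBelow_interval {x y : IntervalDomain n} :
    WayBelow x y ↔ y.carrier ⊆ interior x.carrier :=
  isSetDomain_interval.wayBelow_iff

theorem wayBelow_compact {x y : CompactDomain n} :
    WayBelow x y ↔ y.carrier ⊆ interior x.carrier :=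
  isSetDomain_compact.wayBelow_iff

theorem IntervalDomain.nonempty (x : IntervalDomain n) : x.carrier.Nonempty := by
  rcases x.isBox with h | h
  · rw [h]; exact Set.univ_nonempty
  · exact h.nonempty

theorem wayBelow_point {d : IntervalDomain n} {x : Fin n → ℝ} :
    WayBelow d (IntervalDomain.point x) ↔ x ∈ interior d.carrier := by
  rw [wayBelow_interval]
  exact Set.singleton_subset_iff

theorem le_point {d : IntervalDomain n} {x : Fin n → ℝ} :
    d ≤ IntervalDomain.point x ↔ x ∈ d.carrier :=
  Set.singleton_subset_iff

theorem IntervalDomain.convex (x : IntervalDomain n) : Convex ℝ x.carrier := by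
  rcases x.isBox with h | ⟨a, b, -, h⟩
  · rw [h]; exact convex_univ
  · rw [h]; exact convex_Icc a b

theorem IntervalMap.exists_wayBelow (f : IntervalMap n) (x : IntervalDomain n)
    {U : Set (Fin 1 → ℝ)} (hU : IsOpen U) (h : (f.1 x).carrier ⊆ U) :
    ∃ k, WayBelow (intervalBasis n k) x ∧ (f.1 (intervalBasis n k)).carrier ⊆ U := by
  obtain ⟨_, ⟨k, rfl⟩, hk⟩ :=
    ((isSetDomain_interval.scottContinuous_iff isSetDomain_interval).1 f.2).2 x U hU h
  exact ⟨k, hk⟩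

/-- The pointwise intersection is again Scott-continuous: an open set containing its value at `x`
contains the value of some member of `S` at `x`, and the continuity of that member yields the
required basis element. -/
theorem IntervalMap.exists_iInter {S : Set (IntervalMap n)} (hS : S.Nonempty)
    (hd : DirectedOn (· ≤ ·) S) :
    ∃ g : IntervalMap n, ∀ x, (g.1 x).carrier = ⋂ s ∈ S, (s.1 x).carrier := by
  have hdx : ∀ x, DirectedOn (· ≤ ·) ((fun s : IntervalMap n => s.1 x) '' S) := fun x =>
    directedOn_image.2 (hd.mono' fun _ _ _ _ h => h x)
  choose g hg using fun x => isSetDomain_interval.inter _ (hS.image fun s => s.1 x) (hdx x)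
  simp only [Set.biInter_image] at hg
  refine ⟨⟨g, (isSetDomain_interval.scottContinuous_iff isSetDomain_interval).2 ⟨?_, ?_⟩⟩, hg⟩
  · intro x y hxy
    change (g y).carrier ⊆ (g x).carrier
    rw [hg, hg]
    exact Set.iInter₂_mono fun s _ => s.2.monotone hxy
  · intro x U hU hxU
    rw [hg] at hxU
    have := exists_subset_of_directedOn (c := IntervalDomain.carrier) (fun _ _ => Iff.rfl)
      IntervalDomain.eq_univ_or_compact (hS.image fun s : IntervalMap n => s.1 x) (hdx x) hU
      (by rwa [Set.biInter_image])
    obtain ⟨_, ⟨s, hs, rfl⟩, hsU⟩ := this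
    obtain ⟨k, hk, hkU⟩ := s.exists_wayBelow x hU hsU
    refine ⟨_, ⟨k, rfl⟩, hk, ?_⟩
    rw [hg]
    exact (Set.biInter_subset_of_mem (t := fun s : IntervalMap n => (s.1 _).carrier) hs).trans hkU

theorem IntervalMap.isLUB_of_eq {S : Set (IntervalMap n)} {g : IntervalMap n}
    (hg : ∀ x, (g.1 x).carrier = ⋂ s ∈ S, (s.1 x).carrier) : IsLUB S g := by
  constructor
  · intro s hs x
    change (g.1 x).carrier ⊆ (s.1 x).carrier
    rw [hg]
    exact Set.biInter_subset_of_mem (t := fun s : IntervalMap n => (s.1 _).carrier) hs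
  · intro h hh x
    change (h.1 x).carrier ⊆ (g.1 x).carrier
    rw [hg]
    exact Set.subset_iInter₂ fun s hs => hh hs x

theorem IntervalMap.isLUB_iff {S : Set (IntervalMap n)} (hS : S.Nonempty)
    (hd : DirectedOn (· ≤ ·) S) {g : IntervalMap n} :
    IsLUB S g ↔ ∀ x, (g.1 x).carrier = ⋂ s ∈ S, (s.1 x).carrier := by
  refine ⟨fun h => ?_, IntervalMap.isLUB_of_eq⟩
  obtain ⟨g', hg'⟩ := IntervalMap.exists_iInter hS hd
  rwa [h.unique (IntervalMap.isLUB_of_eq hg')]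

theorem IntervalMap.exists_subset {S : Set (IntervalMap n)} (hS : S.Nonempty)
    (hd : DirectedOn (· ≤ ·) S) {g : IntervalMap n} (hg : IsLUB S g) {x : IntervalDomain n}
    {U : Set (Fin 1 → ℝ)} (hU : IsOpen U) (h : (g.1 x).carrier ⊆ U) :
    ∃ s ∈ S, (s.1 x).carrier ⊆ U := by
  have := exists_subset_of_directedOn (c := IntervalDomain.carrier) (fun _ _ => Iff.rfl)
    IntervalDomain.eq_univ_or_compact (hS.image fun s : IntervalMap n => s.1 x)
    (directedOn_image.2 (hd.mono' fun _ _ _ _ h => h x)) hU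
    (by rwa [Set.biInter_image, ← (IntervalMap.isLUB_iff hS hd).1 hg])
  simpa using this

theorem isDCPO_intervalMap : IsDCPO (IntervalMap n) := fun _ hS hd =>
  (IntervalMap.exists_iInter hS hd).imp fun _ => IntervalMap.isLUB_of_eq

/-- Upper semicontinuity of `x ↦ f {x}`: a basis box around `x` is mapped into `U`, and each point
of that box is above it in the domain order. -/
theorem isOpen_setOf_point_subset (f : IntervalMap n) {U : Set (Fin 1 → ℝ)} (hU : IsOpen U) :
    IsOpen {x | (f.1 (IntervalDomain.point x)).carrier ⊆ U} := by
  rw [isOpen_iff_mem_nhds]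
  intro x hx
  obtain ⟨k, hk, hkU⟩ := f.exists_wayBelow _ hU hx
  filter_upwards [isOpen_interior.mem_nhds (wayBelow_point.1 hk)] with y hy
  have : intervalBasis n k ≤ IntervalDomain.point y := le_point.2 (interior_subset hy)
  exact (show (f.1 (IntervalDomain.point y)).carrier ⊆ (f.1 (intervalBasis n k)).carrier from
    f.2.monotone this).trans hkU

/-- The sets where the members of `S` have values in `U` form a directed open cover of `K`. This
yields the Scott-openness of `EverywhereBelow`. -/
theorem IntervalMap.exists_forall_subset {S : Set (IntervalMap n)} (hS : S.Nonempty)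
    (hd : DirectedOn (· ≤ ·) S) {g : IntervalMap n} (hg : IsLUB S g) {K : Set (Fin n → ℝ)}
    (hK : IsCompact K) {U : Set (Fin 1 → ℝ)} (hU : IsOpen U)
    (h : ∀ x ∈ K, (g.1 (IntervalDomain.point x)).carrier ⊆ U) :
    ∃ s ∈ S, ∀ x ∈ K, (s.1 (IntervalDomain.point x)).carrier ⊆ U := by
  have : Nonempty S := hS.to_subtype
  obtain ⟨⟨s, hs⟩, hsK⟩ := hK.elim_directed_cover
    (fun s : S => {x | (s.1.1 (IntervalDomain.point x)).carrier ⊆ U})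
    (fun s => isOpen_setOf_point_subset s.1 hU)
    (fun x hx => by
      obtain ⟨s, hs, hsU⟩ := IntervalMap.exists_subset hS hd hg hU (h x hx)
      exact Set.mem_iUnion.2 ⟨⟨s, hs⟩, hsU⟩)
    (by
      rintro ⟨s, hs⟩ ⟨t, ht⟩
      obtain ⟨u, hu, hsu, htu⟩ := hd s hs t ht
      exact ⟨⟨u, hu⟩, fun x hx => (show (u.1 _).carrier ⊆ (s.1 _).carrier from hsu _).trans hx,
        fun x hx => (show (u.1 _).carrier ⊆ (t.1 _).carrier from htu _).trans hx⟩)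
  exact ⟨s, hs, hsK⟩

/-! ### Step functions -/

/-- Helly's theorem on the line. It is why consistency of a list of steps need only be checked on
pairs, which makes it decidable. -/
theorem IntervalDomain.iInter_nonempty_of_pairwise {S : Set (IntervalDomain 1)} (hS : S.Finite)
    (h : ∀ d ∈ S, ∀ e ∈ S, (d.carrier ∩ e.carrier).Nonempty) :
    (⋂ d ∈ S, d.carrier).Nonempty := by
  classical
  have := Convex.helly_theorem' (𝕜 := ℝ) (F := IntervalDomain.carrier (n := 1)) (s := hS.toFinset)
    (fun d _ => d.convex) (fun I hI hcard => by
      have h2 : I.card ≤ 2 := by simpa using hcard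
      have hI' : ∀ d ∈ I, d ∈ S := fun d hd => hS.mem_toFinset.1 (hI hd)
      rcases Nat.lt_or_ge I.card 2 with h1 | h1
      · rcases Finset.card_le_one_iff_subset_singleton.1 (Nat.lt_succ_iff.1 h1) with ⟨d, hd⟩
        obtain ⟨x, hx⟩ := d.nonempty
        refine ⟨x, Set.mem_iInter₂.2 fun e he => ?_⟩
        rwa [Finset.mem_singleton.1 (hd he)]
      · obtain ⟨d, e, -, rfl⟩ := Finset.card_eq_two.1 (le_antisymm h2 h1)
        obtain ⟨x, hx⟩ := h d (hI' d (by simp)) e (hI' e (by simp))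
        exact ⟨x, by simpa using hx⟩)
  simpa using this

/-- Values of the list of steps `L` are compatible wherever two steps overlap. -/
def ConsistentSteps (L : List (IntervalDomain n × IntervalDomain 1)) : Prop :=
  ∀ v ∈ L, ∀ w ∈ L, (interior v.1.carrier ∩ interior w.1.carrier).Nonempty →
    (v.2.carrier ∩ w.2.carrier).Nonempty

/-- The value at `x` is the intersection of the values of the steps active at `x`; their regions
share the points of `x`, so these values meet. For continuity, the finitely many steps active at `x`
are all active at some basis element way below `x`. -/
theorem exists_intervalMap_of_consistentSteps {L : List (IntervalDomain n × IntervalDomain 1)}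
    (hL : ConsistentSteps L) : ∃ g : IntervalMap n, ∀ x t,
      t ∈ (g.1 x).carrier ↔ ∀ w ∈ L, WayBelow w.1 x → t ∈ w.2.carrier := by
  have hv : ∀ x : IntervalDomain n, ∃ e : IntervalDomain 1,
      ∀ t, t ∈ e.carrier ↔ ∀ w ∈ L, WayBelow w.1 x → t ∈ w.2.carrier := by
    intro x
    obtain ⟨y, hy⟩ := x.nonempty
    have hfin : {e | ∃ w ∈ L, WayBelow w.1 x ∧ w.2 = e}.Finite :=
      ((List.finite_toSet L).image Prod.snd).subset (by
        rintro _ ⟨w, hw, -, rfl⟩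
        exact ⟨w, hw, rfl⟩)
    obtain ⟨e, he⟩ := IntervalDomain.exists_carrier_eq_iInter
      (IntervalDomain.iInter_nonempty_of_pairwise hfin (by
        rintro _ ⟨v, hv, hvx, rfl⟩ _ ⟨w, hw, hwx, rfl⟩
        exact hL v hv w hw ⟨y, wayBelow_interval.1 hvx hy, wayBelow_interval.1 hwx hy⟩))
    refine ⟨e, fun t => ?_⟩
    rw [he]
    simp only [Set.mem_iInter]
    exact ⟨fun h w hw hwx => h _ ⟨w, hw, hwx, rfl⟩, by
      rintro h _ ⟨w, hw, hwx, rfl⟩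
      exact h w hw hwx⟩
  choose g hg using hv
  refine ⟨⟨g, (isSetDomain_interval.scottContinuous_iff isSetDomain_interval).2 ⟨?_, ?_⟩⟩, hg⟩
  · intro x y hxy t ht
    rw [hg] at ht ⊢
    exact fun w hw hwx => ht w hw (hwx.trans_le hxy)
  · intro x U hU hxU
    have hfin : {w | w ∈ L ∧ WayBelow w.1 x}.Finite :=
      (List.finite_toSet L).subset fun w hw => hw.1
    obtain ⟨b, hb, hbx, hbV⟩ := isSetDomain_interval.exists_wayBelow x
      (U := ⋂ w ∈ {w | w ∈ L ∧ WayBelow w.1 x}, interior w.1.carrier)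
      (hfin.isOpen_biInter fun _ _ => isOpen_interior)
      (Set.subset_iInter₂ fun w hw => wayBelow_interval.1 hw.2)
    refine ⟨b, hb, hbx, fun t ht => hxU ?_⟩
    rw [hg] at ht ⊢
    exact fun w hw hwx => ht w hw (wayBelow_interval.2
      (hbV.trans (Set.biInter_subset_of_mem (show w ∈ {w | w ∈ L ∧ WayBelow w.1 x} from ⟨hw, hwx⟩))))

theorem mem_carrier_singleStep {d x : IntervalDomain n} {e : IntervalDomain 1} {t : Fin 1 → ℝ} :
    t ∈ (singleStep d e x).carrier ↔ (WayBelow d x → t ∈ e.carrier) := by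
  unfold singleStep
  split_ifs with h <;> simp [h]

theorem singleStep_le_iff {d : IntervalDomain n} {e : IntervalDomain 1}
    {g : IntervalDomain n → IntervalDomain 1} :
    singleStep d e ≤ g ↔ ∀ x, WayBelow d x → e ≤ g x := by
  constructor
  · intro h x hx t ht
    exact mem_carrier_singleStep.1 (h x ht) hx
  · intro h x t ht
    exact mem_carrier_singleStep.2 fun hx => h x hx ht

/-- The map built from the intersections is the least upper bound among all functions, hence it is
the one chosen in `stepFunction`. -/
theorem ConsistentSteps.mem_carrier {L : List (IntervalDomain n × IntervalDomain 1)}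
    (hL : ConsistentSteps L) (x : IntervalDomain n) (t : Fin 1 → ℝ) :
    t ∈ ((stepFunction L).1 x).carrier ↔ ∀ w ∈ L, WayBelow w.1 x → t ∈ w.2.carrier := by
  obtain ⟨g, hg⟩ := exists_intervalMap_of_consistentSteps hL
  have hlub : IsLUB {s | ∃ w ∈ L, s = singleStep w.1 w.2} g.1 := by
    constructor
    · rintro _ ⟨w, hw, rfl⟩
      exact singleStep_le_iff.2 fun x hx t ht => (hg x t).1 ht w hw hx
    · intro h hh x t ht
      exact (hg x t).2 fun w hw hx => singleStep_le_iff.1 (hh ⟨w, hw, rfl⟩) x hx ht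
  have hex : ∃ g : IntervalMap n, IsLUB {s | ∃ w ∈ L, s = singleStep w.1 w.2} g.1 := ⟨g, hlub⟩
  have : (stepFunction L).1 = g.1 := by
    rw [stepFunction, dif_pos hex]
    exact hex.choose_spec.unique hlub
  rw [this, hg]

/-- At a point where two steps overlap, the nonempty value of the upper bound `g` lies in both step
values. -/
theorem consistentSteps_of_le {L : List (IntervalDomain n × IntervalDomain 1)}
    {g : IntervalDomain n → IntervalDomain 1} (h : ∀ w ∈ L, singleStep w.1 w.2 ≤ g) :
    ConsistentSteps L := by
  rintro v hv w hw ⟨x, hxv, hxw⟩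
  obtain ⟨t, ht⟩ := (g (IntervalDomain.point x)).nonempty
  exact ⟨t, singleStep_le_iff.1 (h v hv) _ (wayBelow_point.2 hxv) ht,
    singleStep_le_iff.1 (h w hw) _ (wayBelow_point.2 hxw) ht⟩

theorem consistentSteps_nil : ConsistentSteps ([] : List (IntervalDomain n × IntervalDomain 1)) :=
  fun _ h => absurd h List.not_mem_nil

theorem carrier_stepFunction_nil (x : IntervalDomain n) :
    ((stepFunction [] : IntervalMap n).1 x).carrier = Set.univ :=
  Set.eq_univ_of_forall fun t => (consistentSteps_nil.mem_carrier x t).2 (by simp)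

theorem isBot_stepFunction_nil : IsBot (stepFunction [] : IntervalMap n) := fun f x => by
  change (f.1 x).carrier ⊆ _
  rw [carrier_stepFunction_nil]
  exact Set.subset_univ _

theorem stepFunction_of_not_consistentSteps {L : List (IntervalDomain n × IntervalDomain 1)}
    (hL : ¬ ConsistentSteps L) : (stepFunction L : IntervalMap n) = stepFunction [] := by
  have : ¬ ∃ g : IntervalMap n, IsLUB {s | ∃ w ∈ L, s = singleStep w.1 w.2} g.1 :=
    fun ⟨g, hg⟩ => hL (consistentSteps_of_le fun w hw => hg.1 ⟨w, hw, rfl⟩)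
  rw [stepFunction, dif_neg this]
  refine Subtype.ext (funext fun x => IntervalDomain.ext ?_)
  rw [carrier_stepFunction_nil]
  rfl

theorem stepFunction_le_iff {L : List (IntervalDomain n × IntervalDomain 1)}
    (hL : ConsistentSteps L) {g : IntervalMap n} :
    stepFunction L ≤ g ↔ ∀ w ∈ L, ∀ x, WayBelow w.1 x → w.2 ≤ g.1 x := by
  constructor
  · intro h w hw x hx t ht
    exact (hL.mem_carrier x t).1 (h x ht) w hw hx
  · intro h x t ht
    exact (hL.mem_carrier x t).2 fun w hw hx => h w hw x hx ht

/-! ### The way-below relation of the function space -/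

/-- Each step of `L` is either empty or approximates `g`. -/
def StepsBelow (L : List (IntervalDomain n × IntervalDomain 1)) (g : IntervalMap n) : Prop :=
  ∀ w ∈ L, interior w.1.carrier = ∅ ∨ WayBelow w.2 (g.1 w.1)

theorem interior_nonempty_of_wayBelow {d x : IntervalDomain n} (h : WayBelow d x) :
    (interior d.carrier).Nonempty :=
  x.nonempty.mono (wayBelow_interval.1 h)

theorem StepsBelow.wayBelow_of_wayBelow {L : List (IntervalDomain n × IntervalDomain 1)}
    {g : IntervalMap n} (h : StepsBelow L g) {w : IntervalDomain n × IntervalDomain 1}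
    (hw : w ∈ L) {x : IntervalDomain n} (hx : WayBelow w.1 x) : WayBelow w.2 (g.1 w.1) :=
  (h w hw).resolve_left (interior_nonempty_of_wayBelow hx).ne_empty

theorem StepsBelow.consistentSteps {L : List (IntervalDomain n × IntervalDomain 1)}
    {g : IntervalMap n} (h : StepsBelow L g) : ConsistentSteps L :=
  consistentSteps_of_le (g := g.1) fun _ hw => singleStep_le_iff.2 fun _ hx =>
    (h.wayBelow_of_wayBelow hw hx).le.trans (g.2.monotone hx.le)

theorem exists_forall_mem_list {α β : Type*} [Preorder α] {S : Set α} (hS : S.Nonempty)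
    (hd : DirectedOn (· ≤ ·) S) {P : β → α → Prop} (hP : ∀ b s t, s ≤ t → P b s → P b t)
    (L : List β) (h : ∀ b ∈ L, ∃ s ∈ S, P b s) : ∃ s ∈ S, ∀ b ∈ L, P b s := by
  induction L with
  | nil => exact hS.imp fun s hs => ⟨hs, by simp⟩
  | cons b L ih =>
    obtain ⟨s, hs, hsL⟩ := ih fun c hc => h c (List.mem_cons_of_mem _ hc)
    obtain ⟨t, ht, htb⟩ := h b List.mem_cons_self
    obtain ⟨u, hu, hsu, htu⟩ := hd s hs t ht
    refine ⟨u, hu, fun c hc => ?_⟩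
    rcases List.mem_cons.1 hc with rfl | hc
    · exact hP _ _ _ htu htb
    · exact hP _ _ _ hsu (hsL c hc)

/-- For each step with nonempty region, some member of the directed set already maps the region into
the step value; finitely many members have an upper bound in the set. -/
theorem StepsBelow.wayBelow {L : List (IntervalDomain n × IntervalDomain 1)}
    {g : IntervalMap n} (h : StepsBelow L g) : WayBelow (stepFunction L) g := by
  intro S s hS hd hs hgs
  obtain ⟨t, ht, htL⟩ := exists_forall_mem_list hS hd
    (P := fun (w : IntervalDomain n × IntervalDomain 1) (t : IntervalMap n) =>
      ∀ x, WayBelow w.1 x → w.2 ≤ t.1 x)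
    (fun w s t hst hw x hx => (hw x hx).trans (hst x)) L (by
      intro w hw
      rcases h w hw with h0 | h1
      · obtain ⟨t, ht⟩ := hS
        exact ⟨t, ht, fun x hx => absurd h0 (interior_nonempty_of_wayBelow hx).ne_empty⟩
      · obtain ⟨t, ht, hwt⟩ := IntervalMap.exists_subset hS hd hs isOpen_interior
          (wayBelow_interval.1 (h1.trans_le (hgs w.1)))
        exact ⟨t, ht, fun x hx =>
          (show w.2 ≤ t.1 w.1 from hwt.trans interior_subset).trans (t.2.monotone hx.le)⟩)
  exact ⟨t, ht, (stepFunction_le_iff h.consistentSteps).2 htL⟩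

/-- The list of steps with code `j`. -/
noncomputable def stepList (n j : ℕ) : List (IntervalDomain n × IntervalDomain 1) :=
  (Denumerable.ofNat (List (ℕ × ℕ)) j).map fun w => (intervalBasis n w.1, intervalBasis 1 w.2)

theorem stepBasis_eq (j : ℕ) : stepBasis n j = stepFunction (stepList n j) := rfl

theorem stepList_zero : stepList n 0 = [] := by
  simp [stepList]

theorem exists_stepList_append (i j : ℕ) : ∃ k, stepList n k = stepList n i ++ stepList n j :=
  ⟨Encodable.encode (Denumerable.ofNat (List (ℕ × ℕ)) i ++ Denumerable.ofNat (List (ℕ × ℕ)) j), by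
    simp [stepList]⟩

theorem exists_stepList_singleton (i j : ℕ) :
    ∃ k, stepList n k = [(intervalBasis n i, intervalBasis 1 j)] :=
  ⟨Encodable.encode [(i, j)], by simp [stepList, -Encodable.encode_list_cons]⟩

theorem stepFunction_mono {L L' : List (IntervalDomain n × IntervalDomain 1)} (h : L ⊆ L')
    (hL' : ConsistentSteps L') : stepFunction L ≤ stepFunction L' := by
  have hL : ConsistentSteps L := fun v hv w hw => hL' v (h hv) w (h hw)
  exact (stepFunction_le_iff hL).2 fun w hw => (stepFunction_le_iff hL').1 le_rfl w (h hw)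

/-- Directedness comes from concatenating lists. For the supremum, single steps suffice: if `g x ⊆
U`, choose a basis interval `e ⊆ U` with `g x` in its interior, then a basis box `d ≪ x` with `e ≪ g
d`. -/
theorem approximants_intervalMap (g : IntervalMap n) :
    {s | ∃ j, StepsBelow (stepList n j) g ∧ stepBasis n j = s}.Nonempty ∧
    DirectedOn (· ≤ ·) {s | ∃ j, StepsBelow (stepList n j) g ∧ stepBasis n j = s} ∧
    IsLUB {s | ∃ j, StepsBelow (stepList n j) g ∧ stepBasis n j = s} g := by
  refine ⟨⟨_, 0, ?_, rfl⟩, ?_, ?_, ?_⟩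
  · rw [stepList_zero]
    exact fun _ h => absurd h List.not_mem_nil
  · rintro _ ⟨i, hi, rfl⟩ _ ⟨j, hj, rfl⟩
    obtain ⟨k, hk⟩ := exists_stepList_append (n := n) i j
    have hkg : StepsBelow (stepList n k) g := by
      intro w hw
      rw [hk, List.mem_append] at hw
      exact hw.elim (hi w) (hj w)
    exact ⟨_, ⟨k, hkg, rfl⟩,
      stepFunction_mono (L := stepList n i) (L' := stepList n k) (by simp [hk]) hkg.consistentSteps,
      stepFunction_mono (L := stepList n j) (L' := stepList n k) (by simp [hk]) hkg.consistentSteps⟩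
  · rintro _ ⟨j, hj, rfl⟩
    exact hj.wayBelow.le
  · intro h hh x
    refine isSetDomain_interval.subset_of_forall_open fun U hU hxU => ?_
    obtain ⟨_, ⟨j, rfl⟩, hj, hjU⟩ := isSetDomain_interval.approx _ U hU hxU
    obtain ⟨i, hix, hi⟩ := g.exists_wayBelow x isOpen_interior hj
    obtain ⟨k, hk⟩ := exists_stepList_singleton (n := n) i j
    have hkg : StepsBelow (stepList n k) g := by
      simpa [hk, StepsBelow, wayBelow_interval] using Or.inr hi
    have := (stepFunction_le_iff hkg.consistentSteps).1 (hh ⟨k, hkg, rfl⟩)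
      (intervalBasis n i, intervalBasis 1 j) (by simp [hk]) x hix
    exact (show (h.1 x).carrier ⊆ _ from this).trans hjU

/-- Since they are directed with supremum `g`, the step functions of `approximants_intervalMap` are
cofinal among all basis elements way below `g`. -/
theorem isDomainBasis_stepBasis : IsDomainBasis (Set.range (stepBasis n)) := by
  intro g
  obtain ⟨h1, h2, h3⟩ := approximants_intervalMap g
  have hmem : ∀ s ∈ {s | ∃ j, StepsBelow (stepList n j) g ∧ stepBasis n j = s},
      s ∈ {a | a ∈ Set.range (stepBasis n) ∧ WayBelow a g} := by
    rintro _ ⟨j, hj, rfl⟩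
    exact ⟨⟨j, rfl⟩, hj.wayBelow⟩
  refine ⟨h1.mono hmem, ?_, fun a ha => ha.2.le, fun y hy => h3.2 fun s hs => hy (hmem s hs)⟩
  rintro a ⟨-, ha⟩ b ⟨-, hb⟩
  obtain ⟨s, hs, has⟩ := ha _ _ h1 h2 h3 le_rfl
  obtain ⟨t, ht, hbt⟩ := hb _ _ h1 h2 h3 le_rfl
  obtain ⟨u, hu, hsu, htu⟩ := h2 s hs t ht
  exact ⟨u, hmem u hu, has.trans hsu, hbt.trans htu⟩

/-- The witness is the bounding box of `F`, which stays in the interior of `d` because that interior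
is a product of open intervals. -/
theorem exists_wayBelow_of_finset {d : IntervalDomain n} {F : Finset (Fin n → ℝ)}
    (hF : F.Nonempty) (h : ∀ z ∈ F, z ∈ interior d.carrier) :
    ∃ x, WayBelow d x ∧ ∀ z ∈ F, z ∈ x.carrier := by
  rcases d.isBox with hd | ⟨a, b, -, hd⟩
  · exact ⟨⊥, by simp [wayBelow_interval, hd], by simp⟩
  · have hle : F.inf' hF id ≤ F.sup' hF id :=
      (Finset.inf'_le id hF.choose_spec).trans (Finset.le_sup' id hF.choose_spec)
    refine ⟨⟨Set.Icc (F.inf' hF id) (F.sup' hF id), Or.inr ⟨_, _, hle, rfl⟩⟩, ?_, fun z hz =>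
      ⟨Finset.inf'_le id hz, Finset.le_sup' id hz⟩⟩
    rw [wayBelow_interval]
    intro y hy
    rw [hd, mem_interior_Icc_pi]
    rw [mem_Icc_pi] at hy
    have h' : ∀ z ∈ F, ∀ i, a i < z i ∧ z i < b i := fun z hz =>
      mem_interior_Icc_pi.1 (hd ▸ h z hz)
    intro i
    have := hy i
    rw [Finset.inf'_apply, Finset.sup'_apply] at this
    exact ⟨((Finset.lt_inf'_iff _).2 fun z hz => (h' z hz i).1).trans_le this.1,
      this.2.trans_lt ((Finset.sup'_lt_iff _).2 fun z hz => (h' z hz i).2)⟩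

/-- Way above `d` there are elements so close to `d` that only elements below `d` among finitely
many given ones are way below them. -/
theorem exists_wayBelow_separating {d : IntervalDomain n} (hd : (interior d.carrier).Nonempty)
    (L : List (IntervalDomain n)) :
    ∃ x, WayBelow d x ∧ ∀ d' ∈ L, WayBelow d' x → d' ≤ d := by
  classical
  have key : ∀ d' : IntervalDomain n, ∃ z ∈ interior d.carrier, z ∈ d'.carrier → d' ≤ d := by
    intro d'
    by_cases h : interior d.carrier ⊆ d'.carrier
    · obtain ⟨z, hz⟩ := id hd
      refine ⟨z, hz, fun _ => ?_⟩
      -- A convex set with nonempty interior lies in the closure of its interior, and `d'` is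
      -- closed.
      refine (subset_closure.trans ?_ : d.carrier ⊆ d'.carrier)
      rw [← d.convex.closure_interior_eq_closure_of_nonempty_interior hd]
      exact (isSetDomain_interval.isClosed d').closure_subset_iff.2 h
    · obtain ⟨z, hz, hzd⟩ := Set.not_subset.1 h
      exact ⟨z, hz, fun h => absurd h hzd⟩
  choose z hz hzd using key
  -- The box `x` contains a test point for each element of `L`; `z d` is added only to make the
  -- finite set nonempty.
  obtain ⟨x, hx, hxz⟩ := exists_wayBelow_of_finset (d := d) (F := insert (z d) (L.map z).toFinset)
    (Finset.insert_nonempty _ _) (by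
      intro y hy
      rcases Finset.mem_insert.1 hy with rfl | hy
      · exact hz d
      · obtain ⟨d', -, rfl⟩ := List.mem_map.1 (List.mem_toFinset.1 hy)
        exact hz d')
  refine ⟨x, hx, fun d' hd' hdx => hzd d' (interior_subset (wayBelow_interval.1 hdx (hxz _ ?_)))⟩
  exact Finset.mem_insert_of_mem (List.mem_toFinset.2 (List.mem_map_of_mem hd'))

/-- Forwards, the step function lies below some step function `j` that approximates `g`. Given a
step `(d, e)` of `L`, evaluate at a separating `x` with `d ≪ x`: the steps of `j` active there have
regions below `d`, so `g d` lies in the interiors of their values, and the intersection of these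
interiors is an open subset of `e`. A step whose region has empty interior is constantly `⊥` and
imposes nothing. -/
theorem wayBelow_stepFunction_iff {L : List (IntervalDomain n × IntervalDomain 1)}
    (hL : ConsistentSteps L) {g : IntervalMap n} :
    WayBelow (stepFunction L) g ↔ StepsBelow L g := by
  refine ⟨fun h w hw => ?_, StepsBelow.wayBelow⟩
  rcases Set.eq_empty_or_nonempty (interior w.1.carrier) with h0 | h0
  · exact Or.inl h0
  right
  obtain ⟨h1, h2, h3⟩ := approximants_intervalMap g
  obtain ⟨_, ⟨j, hj, rfl⟩, hLj⟩ := h _ _ h1 h2 h3 le_rfl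
  obtain ⟨x, hwx, hx⟩ := exists_wayBelow_separating h0 ((stepList n j).map Prod.fst)
  have hle := (stepFunction_le_iff hL).1 hLj w hw x hwx
  have hfin : {v | v ∈ stepList n j ∧ WayBelow v.1 x}.Finite :=
    (List.finite_toSet (stepList n j)).subset fun w hw => hw.1
  have hsub : (⋂ v ∈ {v | v ∈ stepList n j ∧ WayBelow v.1 x}, interior v.2.carrier) ⊆
      w.2.carrier := by
    intro t ht
    refine hle ((hj.consistentSteps.mem_carrier x t).2 fun v hv hvx => ?_)
    exact interior_subset (Set.mem_iInter₂.1 ht v ⟨hv, hvx⟩)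
  rw [wayBelow_interval]
  refine Set.Subset.trans (Set.subset_iInter₂ fun v hv => ?_)
    (interior_maximal hsub (hfin.isOpen_biInter fun _ _ => isOpen_interior))
  refine wayBelow_interval.1 ((hj.wayBelow_of_wayBelow hv.1 hv.2).trans_le (g.2.monotone ?_))
  exact hx v.1 (List.mem_map_of_mem hv.1) hv.2

end FunctionSpace

/-! ### Maximum value and maximum set -/

section Maximum

variable {n : ℕ}

namespace ScottOpen

variable {D : Type*} [PartialOrder D] {P Q : D → Prop}

theorem const (p : Prop) : ScottOpen fun _ : D => p := fun _ _ hS _ _ =>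
  ⟨fun h => hS.imp fun _ hs => ⟨hs, h⟩, fun ⟨_, _, h⟩ => h⟩

theorem and (hP : ScottOpen P) (hQ : ScottOpen Q) : ScottOpen fun x => P x ∧ Q x := by
  intro S s hS hd hs
  constructor
  · rintro ⟨h1, h2⟩
    obtain ⟨d, hdS, hPd⟩ := (hP S s hS hd hs).1 h1
    obtain ⟨e, heS, hQe⟩ := (hQ S s hS hd hs).1 h2
    obtain ⟨u, huS, hdu, heu⟩ := hd d hdS e heS
    exact ⟨u, huS, hP.mono hdu hPd, hQ.mono heu hQe⟩
  · rintro ⟨d, hdS, h1, h2⟩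
    exact ⟨(hP S s hS hd hs).2 ⟨d, hdS, h1⟩, (hQ S s hS hd hs).2 ⟨d, hdS, h2⟩⟩

theorem or (hP : ScottOpen P) (hQ : ScottOpen Q) : ScottOpen fun x => P x ∨ Q x := by
  intro S s hS hd hs
  simp only [hP S s hS hd hs, hQ S s hS hd hs, and_or_left, exists_or]

theorem exists_index {ι : Type*} {P : ι → D → Prop} (hP : ∀ i, ScottOpen (P i)) :
    ScottOpen fun x => ∃ i, P i x := by
  intro S s hS hd hs
  simp only [fun i => hP i S s hS hd hs]
  exact ⟨fun ⟨i, d, hd, h⟩ => ⟨d, hd, i, h⟩, fun ⟨d, hd, i, h⟩ => ⟨i, d, hd, h⟩⟩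

theorem congr (hP : ScottOpen P) (h : ∀ x, Q x ↔ P x) : ScottOpen Q :=
  (funext fun x => propext (h x) : Q = P) ▸ hP

end ScottOpen

/-! ### End points of intervals, half-spaces and attained maxima -/

/-- The open half-space above `r`. -/
def above (r : ℝ) : Set (Fin 1 → ℝ) := {t | r < t 0}

/-- The open half-space below `r`. -/
def below (r : ℝ) : Set (Fin 1 → ℝ) := {t | t 0 < r}

theorem isOpen_above (r : ℝ) : IsOpen (above r) := isOpen_lt continuous_const (continuous_apply 0)

theorem isOpen_below (r : ℝ) : IsOpen (below r) := isOpen_lt (continuous_apply 0) continuous_const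

theorem interior_Icc_eq (p q : Fin 1 → ℝ) : interior (Set.Icc p q) = above (p 0) ∩ below (q 0) := by
  ext t
  simp [mem_interior_Icc_pi, above, below]

theorem IntervalDomain.lt_lower_iff {I : IntervalDomain 1} {r : ℝ} :
    (r : EReal) < I.lower ↔ I.carrier ⊆ above r := by
  constructor
  · intro h t ht
    exact EReal.coe_lt_coe_iff.1 (h.trans_le (iInf₂_le t ht))
  · intro h
    rcases I.isBox with hI | ⟨p, q, hpq, hI⟩
    · exact absurd (h (hI ▸ Set.mem_univ fun _ => r)) (lt_irrefl r)
    · have hp : p ∈ I.carrier := hI ▸ Set.left_mem_Icc.2 hpq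
      refine (EReal.coe_lt_coe_iff.2 (h hp)).trans_le (le_iInf₂ fun t ht => ?_)
      rw [hI] at ht
      exact EReal.coe_le_coe_iff.2 (ht.1 0)

theorem IntervalDomain.upper_lt_iff {I : IntervalDomain 1} {r : ℝ} :
    I.upper < (r : EReal) ↔ I.carrier ⊆ below r := by
  constructor
  · intro h t ht
    exact EReal.coe_lt_coe_iff.1 ((le_iSup₂ (f := fun (t : Fin 1 → ℝ) (_ : t ∈ I.carrier) =>
      ((t 0 : ℝ) : EReal)) t ht).trans_lt h)
  · intro h
    rcases I.isBox with hI | ⟨p, q, hpq, hI⟩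
    · exact absurd (h (hI ▸ Set.mem_univ fun _ => r)) (lt_irrefl r)
    · have hq : q ∈ I.carrier := hI ▸ Set.right_mem_Icc.2 hpq
      refine lt_of_le_of_lt (iSup₂_le fun t ht => ?_) (EReal.coe_lt_coe_iff.2 (h hq))
      rw [hI] at ht
      exact EReal.coe_le_coe_iff.2 (ht.2 0)

theorem IntervalDomain.lower_le_upper (I : IntervalDomain 1) : I.lower ≤ I.upper := by
  obtain ⟨t, ht⟩ := I.nonempty
  exact (iInf₂_le t ht).trans (le_iSup₂ (f := fun (t : Fin 1 → ℝ) (_ : t ∈ I.carrier) =>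
      ((t 0 : ℝ) : EReal)) t ht)

theorem upperSemicontinuous_upper (f : IntervalMap n) :
    UpperSemicontinuous fun x => (f.1 (IntervalDomain.point x)).upper := by
  intro x y hy
  obtain ⟨r, h1, h2⟩ := EReal.lt_iff_exists_real_btwn.1 hy
  filter_upwards [(isOpen_setOf_point_subset f (isOpen_below r)).mem_nhds
    (IntervalDomain.upper_lt_iff.1 h1)] with z hz
  exact (IntervalDomain.upper_lt_iff.2 hz).trans h2

variable {X : Set (Fin n → ℝ)}

theorem exists_upper_max (f : IntervalMap n) (hX : X.Nonempty) (hc : IsCompact X) :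
    ∃ x ∈ X, ∀ y ∈ X, (f.1 (IntervalDomain.point y)).upper ≤ (f.1 (IntervalDomain.point x)).upper :=
  ((upperSemicontinuous_upper f).upperSemicontinuousOn X).exists_isMaxOn hX hc

theorem lower_le_maxLower (f : IntervalMap n) {x : Fin n → ℝ} (hx : x ∈ X) :
    (f.1 (IntervalDomain.point x)).lower ≤ maxLower f X :=
  le_iSup₂ (f := fun x (_ : x ∈ X) => (f.1 (IntervalDomain.point x)).lower) x hx

theorem upper_le_maxUpper (f : IntervalMap n) {x : Fin n → ℝ} (hx : x ∈ X) :
    (f.1 (IntervalDomain.point x)).upper ≤ maxUpper f X :=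
  le_iSup₂ (f := fun x (_ : x ∈ X) => (f.1 (IntervalDomain.point x)).upper) x hx

theorem maxLower_le_maxUpper (f : IntervalMap n) (X : Set (Fin n → ℝ)) :
    maxLower f X ≤ maxUpper f X :=
  iSup₂_mono fun _ _ => IntervalDomain.lower_le_upper _

theorem lt_maxLower_iff {f : IntervalMap n} {r : ℝ} :
    (r : EReal) < maxLower f X ↔ ∃ x ∈ X, (f.1 (IntervalDomain.point x)).carrier ⊆ above r := by
  simp only [maxLower, lt_iSup_iff, IntervalDomain.lt_lower_iff, exists_prop]

/-- The supremum is attained, so strict pointwise bounds pass to it. -/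
theorem maxUpper_lt_iff {f : IntervalMap n} {r : ℝ} (hX : X.Nonempty) (hc : IsCompact X) :
    maxUpper f X < (r : EReal) ↔ ∀ x ∈ X, (f.1 (IntervalDomain.point x)).carrier ⊆ below r := by
  simp only [← IntervalDomain.upper_lt_iff]
  constructor
  · exact fun h x hx => (upper_le_maxUpper f hx).trans_lt h
  · intro h
    obtain ⟨x, hx, hmax⟩ := exists_upper_max f hX hc
    exact (iSup₂_le hmax).trans_lt (h x hx)

/-- Of the inequalities that make the two intervals meet, only this one is not automatic. -/
theorem mem_maxSet_iff {f : IntervalMap n} {x : Fin n → ℝ} :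
    x ∈ maxSet f X ↔ x ∈ X ∧ maxLower f X ≤ (f.1 (IntervalDomain.point x)).upper := by
  refine and_congr_right fun hx => ?_
  rw [Set.Icc_inter_Icc, Set.nonempty_Icc, sup_le_iff, le_inf_iff, le_inf_iff]
  have h1 := lower_le_maxLower f hx
  have h2 := upper_le_maxUpper f hx
  have h3 := maxLower_le_maxUpper f X
  have h4 := (f.1 (IntervalDomain.point x)).lower_le_upper
  exact ⟨fun h => h.2.1, fun h => ⟨⟨h4, h1.trans h3⟩, h, h3⟩⟩

theorem maxSet_nonempty (f : IntervalMap n) (hX : X.Nonempty) (hc : IsCompact X) :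
    (maxSet f X).Nonempty := by
  obtain ⟨x, hx, hmax⟩ := exists_upper_max f hX hc
  exact ⟨x, mem_maxSet_iff.2 ⟨hx, (maxLower_le_maxUpper f X).trans (iSup₂_le hmax)⟩⟩

theorem isCompact_maxSet (f : IntervalMap n) (hc : IsCompact X) : IsCompact (maxSet f X) := by
  have : maxSet f X = X ∩ (fun x => (f.1 (IntervalDomain.point x)).upper) ⁻¹' Set.Ici (maxLower f X) :=
    Set.ext fun x => mem_maxSet_iff
  rw [this]
  exact hc.inter_right ((upperSemicontinuous_upper f).isClosed_preimage _)

theorem carrier_maxS (f : IntervalMap n) (hX : X.Nonempty) (hc : IsCompact X) :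
    (maxS f X).carrier = maxSet f X :=
  CompactDomain.carrier_ofSet ⟨maxSet_nonempty f hX hc, isCompact_maxSet f hc⟩

/-! ### Scott-open conditions describing the maximum value and the maximum set -/

/-- The values of `f` are somewhere on `X` above `r`. -/
def SomewhereAbove (X : Set (Fin n → ℝ)) (r : ℝ) (f : IntervalMap n) : Prop :=
  ∃ x ∈ X, (f.1 (IntervalDomain.point x)).carrier ⊆ above r

/-- The values of `f` are everywhere on `K` below `r`. -/
def EverywhereBelow (K : Set (Fin n → ℝ)) (r : ℝ) (f : IntervalMap n) : Prop :=
  ∀ x ∈ K, (f.1 (IntervalDomain.point x)).carrier ⊆ below r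

theorem scottOpen_somewhereAbove (X : Set (Fin n → ℝ)) (r : ℝ) :
    ScottOpen (SomewhereAbove X r) := by
  intro S s hS hd hs
  constructor
  · rintro ⟨x, hx, h⟩
    obtain ⟨d, hdS, hdx⟩ := IntervalMap.exists_subset hS hd hs (isOpen_above r) h
    exact ⟨d, hdS, x, hx, hdx⟩
  · rintro ⟨d, hdS, x, hx, h⟩
    exact ⟨x, hx, (show (s.1 _).carrier ⊆ (d.1 _).carrier from hs.1 hdS _).trans h⟩

theorem scottOpen_everywhereBelow {K : Set (Fin n → ℝ)} (hK : IsCompact K) (r : ℝ) :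
    ScottOpen (EverywhereBelow K r) := by
  intro S s hS hd hs
  constructor
  · exact IntervalMap.exists_forall_subset hS hd hs hK (isOpen_below r)
  · rintro ⟨d, hdS, h⟩ x hx
    exact (show (s.1 _).carrier ⊆ (d.1 _).carrier from hs.1 hdS _).trans (h x hx)

/-- The convention for `⊥` is harmless: the whole line fits in no bounded interval, and the right
side forces both ends to be finite. -/
theorem maxV_subset_iff {f : IntervalMap n} (hX : X.Nonempty) (hc : IsCompact X)
    {p q : Fin 1 → ℝ} : (maxV f X).carrier ⊆ interior (Set.Icc p q) ↔
      SomewhereAbove X (p 0) f ∧ EverywhereBelow X (q 0) f := by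
  unfold SomewhereAbove EverywhereBelow
  rw [← lt_maxLower_iff, ← maxUpper_lt_iff hX hc, interior_Icc_eq]
  have hle := maxLower_le_maxUpper f X
  constructor
  · intro h
    by_cases hbox : IsHyperbox {t : Fin 1 → ℝ | maxLower f X ≤ ((t 0 : ℝ) : EReal) ∧
        ((t 0 : ℝ) : EReal) ≤ maxUpper f X}
    · rw [maxV, IntervalDomain.carrier_ofSet hbox] at h
      obtain ⟨a, b, hab, heq⟩ := hbox
      have ha : a ∈ Set.Icc a b := Set.left_mem_Icc.2 hab
      have hb : b ∈ Set.Icc a b := Set.right_mem_Icc.2 hab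
      rw [← heq] at ha hb
      constructor
      · by_contra hlt
        -- If `maxLower f X ≤ p 0`, this point belongs to the maximum value without being above `p
        -- 0`.
        have hmem := h (show (fun _ => min (p 0) (a 0)) ∈ _ from ⟨?_, ?_⟩)
        · exact (min_le_left (p 0) (a 0)).not_gt hmem.1
        · change maxLower f X ≤ ((min (p 0) (a 0) : ℝ) : EReal)
          rcases min_choice (p 0) (a 0) with h' | h' <;> rw [h']
          · exact not_lt.1 hlt
          · exact ha.1
        · exact (EReal.coe_le_coe_iff.2 (min_le_right _ _)).trans ha.2
      · by_contra hlt
        have hmem := h (show (fun _ => max (q 0) (b 0)) ∈ _ from ⟨?_, ?_⟩)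
        · exact (le_max_left (q 0) (b 0)).not_gt hmem.2
        · exact hb.1.trans (EReal.coe_le_coe_iff.2 (le_max_right _ _))
        · change ((max (q 0) (b 0) : ℝ) : EReal) ≤ maxUpper f X
          rcases max_choice (q 0) (b 0) with h' | h' <;> rw [h']
          · exact not_lt.1 hlt
          · exact hb.2
    · rw [maxV, IntervalDomain.ofSet, dif_neg hbox] at h
      exact absurd (h (Set.mem_univ fun _ => p 0)).1 (lt_irrefl (p 0))
  · rintro ⟨h1, h2⟩
    obtain ⟨a, ha⟩ : ∃ a : ℝ, (a : EReal) = maxLower f X :=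
      ⟨_, EReal.coe_toReal (hle.trans_lt (h2.trans (EReal.coe_lt_top _))).ne
        ((EReal.bot_lt_coe _).trans h1).ne'⟩
    obtain ⟨b, hb⟩ : ∃ b : ℝ, (b : EReal) = maxUpper f X :=
      ⟨_, EReal.coe_toReal (h2.trans (EReal.coe_lt_top _)).ne
        ((EReal.bot_lt_coe _).trans (h1.trans_le hle)).ne'⟩
    rw [maxV, IntervalDomain.carrier_ofSet]
    · rintro t ⟨ht1, ht2⟩
      exact ⟨EReal.coe_lt_coe_iff.1 (h1.trans_le ht1), EReal.coe_lt_coe_iff.1 (ht2.trans_lt h2)⟩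
    · refine ⟨fun _ => a, fun _ => b, fun _ => ?_, ?_⟩
      · rw [← ha, ← hb] at hle
        exact EReal.coe_le_coe_iff.1 hle
      · ext t
        rw [mem_Icc_pi]
        simp [← ha, ← hb]

/-- On the compact set `X \ U` the upper end points attain a maximum; it is below `maxLower f X`,
since the maximum set avoids `X \ U`, and a rational fits between. The case `X ⊆ U` is separate
because then no such rational need exist, for instance for `f = ⊥`. -/
theorem maxSet_subset_iff {f : IntervalMap n} (hc : IsCompact X)
    {U : Set (Fin n → ℝ)} (hU : IsOpen U) : maxSet f X ⊆ U ↔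
      X ⊆ U ∨ ∃ k, SomewhereAbove X (ratOfNat k) f ∧ EverywhereBelow (X \ U) (ratOfNat k) f := by
  constructor
  · intro h
    rw [or_iff_not_imp_left]
    intro hXU
    obtain ⟨x, hx, hmax⟩ := exists_upper_max f (Set.sdiff_nonempty.2 hXU) (hc.diff hU)
    have hlt : (f.1 (IntervalDomain.point x)).upper < maxLower f X := by
      by_contra hle
      exact hx.2 (h (mem_maxSet_iff.2 ⟨hx.1, not_lt.1 hle⟩))
    obtain ⟨q, hq1, hq2⟩ := EReal.lt_iff_exists_rat_btwn.1 hlt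
    obtain ⟨k, rfl⟩ := ratOfNat_surjective q
    exact ⟨k, lt_maxLower_iff.1 hq2, fun y hy =>
      IntervalDomain.upper_lt_iff.1 ((hmax y hy).trans_lt hq1)⟩
  · rintro (h | ⟨k, h1, h2⟩) x hx
    · exact h (mem_maxSet_iff.1 hx).1
    · rw [mem_maxSet_iff] at hx
      by_contra hxU
      exact lt_irrefl _ (((lt_maxLower_iff.2 h1).trans_le hx.2).trans
        (IntervalDomain.upper_lt_iff.2 (h2 x ⟨hx.1, hxU⟩)))

theorem scottOpen_maxSet_subset (hc : IsCompact X) {U : Set (Fin n → ℝ)} (hU : IsOpen U) :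
    ScottOpen fun f : IntervalMap n => maxSet f X ⊆ U :=
  ((ScottOpen.const _).or (ScottOpen.exists_index fun k =>
    (scottOpen_somewhereAbove X (ratOfNat k)).and
      (scottOpen_everywhereBelow (hc.diff hU) (ratOfNat k)))).congr fun _ => maxSet_subset_iff hc hU

theorem wayBelow_maxS_iff (hX : X.Nonempty) (hc : IsCompact X) {f : IntervalMap n}
    {C : CompactDomain n} : WayBelow C (maxS f X) ↔ maxSet f X ⊆ interior C.carrier := by
  rw [wayBelow_compact, carrier_maxS f hX hc]

theorem openAt_maxS (hX : X.Nonempty) (hc : IsCompact X) (C : CompactDomain n) :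
    OpenAt (fun f : IntervalMap n => maxS f X) C :=
  (scottOpen_maxSet_subset hc isOpen_interior).congr fun _ => wayBelow_maxS_iff hX hc

theorem openAt_maxV (hX : X.Nonempty) (hc : IsCompact X) (I : IntervalDomain 1) :
    OpenAt (fun f : IntervalMap n => maxV f X) I := by
  rcases I.isBox with h | ⟨p, q, -, h⟩
  · exact (ScottOpen.const True).congr fun f => by simp [wayBelow_interval, h]
  · exact ((scottOpen_somewhereAbove X (p 0)).and (scottOpen_everywhereBelow hc (q 0))).congr
      fun f => by rw [wayBelow_interval, h, maxV_subset_iff hX hc]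

end Maximum

/-! ### Primitive recursive predicates on codes -/

section Codes

variable {α : Type*} [Primcodable α] {n : ℕ}

/-- The real number with code `k`. -/
abbrev codeReal (k : ℕ) : ℝ := (ratOfNat k : ℝ)

/-- Cross-multiplication with the subtracted terms moved across, so that only natural numbers are
compared. -/
theorem ratOfNat_le_iff (a b : ℕ) : ratOfNat a ≤ ratOfNat b ↔
    a.unpair.1.unpair.1 * (b.unpair.2 + 1) + b.unpair.1.unpair.2 * (a.unpair.2 + 1) ≤
    b.unpair.1.unpair.1 * (a.unpair.2 + 1) + a.unpair.1.unpair.2 * (b.unpair.2 + 1) := by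
  unfold ratOfNat
  rw [div_le_div_iff₀ (by positivity) (by positivity), ← Nat.cast_le (α := ℚ)]
  push_cast
  constructor <;> intro h <;> linarith

theorem primrecRel_ratOfNat_le : PrimrecRel fun a b : ℕ => ratOfNat a ≤ ratOfNat b := by
  have h1 : Primrec fun k : ℕ => k.unpair.1.unpair.1 :=
    Primrec.fst.comp (Primrec.unpair.comp (Primrec.fst.comp Primrec.unpair))
  have h2 : Primrec fun k : ℕ => k.unpair.1.unpair.2 :=
    Primrec.snd.comp (Primrec.unpair.comp (Primrec.fst.comp Primrec.unpair))
  have h3 : Primrec fun k : ℕ => k.unpair.2 + 1 :=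
    Primrec.succ.comp (Primrec.snd.comp Primrec.unpair)
  refine (PrimrecRel.comp (α := ℕ × ℕ) Primrec.nat_le ?_ ?_).of_eq fun x =>
    (ratOfNat_le_iff x.1 x.2).symm
  · exact Primrec.nat_add.comp
      (Primrec.nat_mul.comp (h1.comp Primrec.fst) (h3.comp Primrec.snd))
      (Primrec.nat_mul.comp (h2.comp Primrec.snd) (h3.comp Primrec.fst))
  · exact Primrec.nat_add.comp
      (Primrec.nat_mul.comp (h1.comp Primrec.snd) (h3.comp Primrec.fst))
      (Primrec.nat_mul.comp (h2.comp Primrec.fst) (h3.comp Primrec.snd))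

theorem primrecPred_codeReal_le {f g : α → ℕ} (hf : Primrec f) (hg : Primrec g) :
    PrimrecPred fun a => codeReal (f a) ≤ codeReal (g a) :=
  (PrimrecRel.comp primrecRel_ratOfNat_le hf hg).of_eq fun _ => Rat.cast_le.symm

theorem primrecPred_codeReal_lt {f g : α → ℕ} (hf : Primrec f) (hg : Primrec g) :
    PrimrecPred fun a => codeReal (f a) < codeReal (g a) :=
  (primrecPred_codeReal_le hg hf).not.of_eq fun _ => not_le

/-- A code of the lower end of the `i`-th side of the box with code `k`. -/
def lowerCode (k i : ℕ) : ℕ :=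
  let w := (Denumerable.ofNat (List (ℕ × ℕ)) k).getD i (0, 0)
  if ratOfNat w.1 ≤ ratOfNat w.2 then w.1 else w.2

/-- A code of the upper end of the `i`-th side of the box with code `k`. -/
def upperCode (k i : ℕ) : ℕ :=
  let w := (Denumerable.ofNat (List (ℕ × ℕ)) k).getD i (0, 0)
  if ratOfNat w.1 ≤ ratOfNat w.2 then w.2 else w.1

theorem primrec_side : Primrec fun x : ℕ × ℕ =>
    (Denumerable.ofNat (List (ℕ × ℕ)) x.1).getD x.2 (0, 0) :=
  (Primrec.list_getD (0, 0)).comp ((Primrec.ofNat (List (ℕ × ℕ))).comp Primrec.fst) Primrec.snd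

theorem primrec_lowerCode {f g : α → ℕ} (hf : Primrec f) (hg : Primrec g) :
    Primrec fun a => lowerCode (f a) (g a) := by
  have h := primrec_side.comp (hf.pair hg)
  exact Primrec.ite (PrimrecRel.comp (R := fun a b => ratOfNat a ≤ ratOfNat b)
    primrecRel_ratOfNat_le (Primrec.fst.comp h) (Primrec.snd.comp h)) (Primrec.fst.comp h) (Primrec.snd.comp h)

theorem primrec_upperCode {f g : α → ℕ} (hf : Primrec f) (hg : Primrec g) :
    Primrec fun a => upperCode (f a) (g a) := by
  have h := primrec_side.comp (hf.pair hg)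
  exact Primrec.ite (PrimrecRel.comp (R := fun a b => ratOfNat a ≤ ratOfNat b)
    primrecRel_ratOfNat_le (Primrec.fst.comp h) (Primrec.snd.comp h)) (Primrec.snd.comp h) (Primrec.fst.comp h)

theorem ratBox_eq (k : ℕ) : ratBox n k =
    Set.Icc (fun i : Fin n => codeReal (lowerCode k i)) (fun i => codeReal (upperCode k i)) := by
  unfold ratBox
  congr 1 <;> funext i <;> simp only [ratPair, lowerCode, upperCode, min_def, max_def] <;>
    split_ifs <;> rfl

theorem lowerCode_le_upperCode (k i : ℕ) :
    codeReal (lowerCode k i) ≤ codeReal (upperCode k i) := by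
  simp only [lowerCode, upperCode, Rat.cast_le]
  split_ifs with h
  · exact h
  · exact (not_le.1 h).le

theorem primrecPred_forall_fin (n : ℕ) {p : α → ℕ → Prop} (hp : PrimrecRel p) :
    PrimrecPred fun a => ∀ i : Fin n, p a i :=
  (PrimrecPred.forall_mem (Primrec.const (List.range n)) hp).of_eq fun a => by
    simp only [List.mem_range]
    exact ⟨fun h i => h i i.2, fun h i hi => h ⟨i, hi⟩⟩

/-- Case distinction for the indices of the basis of an interval domain. -/
theorem primrecPred_of_cases {p : α → ℕ → Prop} {q : α → Prop} {r : α → ℕ → Prop} {f : α → ℕ}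
    (hf : Primrec f) (hq : PrimrecPred q) (hr : PrimrecRel r) (h0 : ∀ a, p a 0 ↔ q a)
    (h1 : ∀ a k, p a (k + 1) ↔ r a k) : PrimrecPred fun a => p a (f a) := by
  have hz : PrimrecPred fun a => f a = 0 := PrimrecRel.comp Primrec.eq hf (Primrec.const 0)
  refine ((hz.and hq).or (hz.not.and
    (PrimrecRel.comp hr Primrec.id (Primrec.pred.comp hf)))).of_eq fun a => ?_
  rcases f a with _ | k
  · simp [h0]
  · simp [h1]

theorem primrecPred_ratBox_subset_interior {f g : α → ℕ} (hf : Primrec f) (hg : Primrec g) :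
    PrimrecPred fun a => ratBox n (g a) ⊆ interior (ratBox n (f a)) := by
  have hf' : Primrec fun x : α × ℕ => f x.1 := hf.comp Primrec.fst
  have hg' : Primrec fun x : α × ℕ => g x.1 := hg.comp Primrec.fst
  refine (primrecPred_forall_fin n (p := fun a i =>
    codeReal (lowerCode (f a) i) < codeReal (lowerCode (g a) i) ∧
      codeReal (upperCode (g a) i) < codeReal (upperCode (f a) i))
    ((primrecPred_codeReal_lt (primrec_lowerCode hf' Primrec.snd)
      (primrec_lowerCode hg' Primrec.snd)).and
      (primrecPred_codeReal_lt (primrec_upperCode hg' Primrec.snd)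
        (primrec_upperCode hf' Primrec.snd)))).of_eq fun a => ?_
  rw [ratBox_eq, ratBox_eq]
  constructor
  · intro h x hx
    rw [mem_Icc_pi] at hx
    rw [mem_interior_Icc_pi]
    exact fun i => ⟨(h i).1.trans_le (hx i).1, (hx i).2.trans_lt (h i).2⟩
  · intro h i
    have hle : (fun i : Fin n => codeReal (lowerCode (g a) i)) ≤
      fun i : Fin n => codeReal (upperCode (g a) i) := fun i => lowerCode_le_upperCode _ _
    exact ⟨(mem_interior_Icc_pi.1 (h (Set.left_mem_Icc.2 hle)) i).1,
      (mem_interior_Icc_pi.1 (h (Set.right_mem_Icc.2 hle)) i).2⟩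

/-- A coordinate is needed: for `n = 0` every box is the whole one-point space. -/
theorem not_univ_subset_interior_ratBox (hn : 1 ≤ n) (k : ℕ) :
    ¬ Set.univ ⊆ interior (ratBox n k) := by
  intro h
  rw [ratBox_eq] at h
  have := (mem_interior_Icc_pi.1 (h (Set.mem_univ fun i : Fin n => codeReal (lowerCode k i))) ⟨0, hn⟩).1
  exact lt_irrefl _ this

theorem primrecPred_wayBelow_interval (hn : 1 ≤ n) {f g : α → ℕ} (hf : Primrec f)
    (hg : Primrec g) :
    PrimrecPred fun a => WayBelow (intervalBasis n (f a)) (intervalBasis n (g a)) := by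
  refine primrecPred_of_cases
    (p := fun a i => WayBelow (intervalBasis n i) (intervalBasis n (g a))) hf
    (primrecPred_const True) (r := fun a k => WayBelow (intervalBasis n (k + 1))
      (intervalBasis n (g a))) ?_ (fun a => ?_) (fun a k => Iff.rfl)
  · refine primrecPred_of_cases (p := fun (x : α × ℕ) j =>
      WayBelow (intervalBasis n (x.2 + 1)) (intervalBasis n j)) (hg.comp Primrec.fst)
      (primrecPred_const False) (r := fun x l => ratBox n l ⊆ interior (ratBox n x.2)) ?_
      (fun x => ?_) (fun x l => ?_)
    · exact primrecPred_ratBox_subset_interior (Primrec.snd.comp Primrec.fst) Primrec.snd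
    · rw [wayBelow_interval, carrier_intervalBasis_succ]
      exact iff_false_intro (not_univ_subset_interior_ratBox hn _)
    · rw [wayBelow_interval, carrier_intervalBasis_succ, carrier_intervalBasis_succ]
  · rw [wayBelow_interval, intervalBasis_zero]
    simp

theorem interior_Icc_inter_nonempty {a b c d : Fin n → ℝ} :
    (interior (Set.Icc a b) ∩ interior (Set.Icc c d)).Nonempty ↔
      ∀ i, (a i < b i ∧ a i < d i) ∧ c i < b i ∧ c i < d i := by
  constructor
  · rintro ⟨x, h1, h2⟩ i
    have h1 := mem_interior_Icc_pi.1 h1 i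
    have h2 := mem_interior_Icc_pi.1 h2 i
    exact ⟨⟨h1.1.trans h1.2, h1.1.trans h2.2⟩, h2.1.trans h1.2, h2.1.trans h2.2⟩
  · intro h
    have hlt : ∀ i, ∃ t, max (a i) (c i) < t ∧ t < min (b i) (d i) := fun i =>
      exists_between (max_lt (lt_min (h i).1.1 (h i).1.2) (lt_min (h i).2.1 (h i).2.2))
    choose x hx using hlt
    simp only [max_lt_iff, lt_min_iff] at hx
    exact ⟨x, mem_interior_Icc_pi.2 fun i => ⟨(hx i).1.1, (hx i).2.1⟩,
      mem_interior_Icc_pi.2 fun i => ⟨(hx i).1.2, (hx i).2.2⟩⟩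

/-- The closed box may be degenerate, so `a i < b i` is not among the conditions; where `c i < a i`
the left end `a i` itself serves as coordinate. -/
theorem Icc_inter_interior_nonempty {a b c d : Fin n → ℝ} (hab : a ≤ b) :
    (Set.Icc a b ∩ interior (Set.Icc c d)).Nonempty ↔ ∀ i, a i < d i ∧ c i < b i ∧ c i < d i := by
  constructor
  · rintro ⟨x, h1, h2⟩ i
    have h1 := mem_Icc_pi.1 h1 i
    have h2 := mem_interior_Icc_pi.1 h2 i
    exact ⟨h1.1.trans_lt h2.2, h2.1.trans_le h1.2, h2.1.trans h2.2⟩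
  · intro h
    have hlt : ∀ i, ∃ t, (a i ≤ t ∧ t ≤ b i) ∧ c i < t ∧ t < d i := by
      intro i
      rcases lt_or_ge (c i) (a i) with hca | hac
      · exact ⟨a i, ⟨le_rfl, hab i⟩, hca, (h i).1⟩
      · obtain ⟨t, h1, h2⟩ := exists_between (lt_min (h i).2.1 (h i).2.2)
        rw [lt_min_iff] at h2
        exact ⟨t, ⟨hac.trans h1.le, h2.1.le⟩, h1, h2.2⟩
    choose x hx using hlt
    exact ⟨x, mem_Icc_pi.2 fun i => (hx i).1, mem_interior_Icc_pi.2 fun i => (hx i).2⟩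

theorem primrecPred_interior_ratBox_inter {f g : α → ℕ} (hf : Primrec f) (hg : Primrec g) :
    PrimrecPred fun a => (interior (ratBox n (f a)) ∩ interior (ratBox n (g a))).Nonempty := by
  have hf' : Primrec fun x : α × ℕ => f x.1 := hf.comp Primrec.fst
  have hg' : Primrec fun x : α × ℕ => g x.1 := hg.comp Primrec.fst
  have hlf := primrec_lowerCode hf' Primrec.snd
  have hlg := primrec_lowerCode hg' Primrec.snd
  have huf := primrec_upperCode hf' Primrec.snd
  have hug := primrec_upperCode hg' Primrec.snd
  refine (primrecPred_forall_fin n (((primrecPred_codeReal_lt hlf huf).and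
    (primrecPred_codeReal_lt hlf hug)).and ((primrecPred_codeReal_lt hlg huf).and
    (primrecPred_codeReal_lt hlg hug))).primrecRel).of_eq fun a => ?_
  rw [ratBox_eq, ratBox_eq, interior_Icc_inter_nonempty]

theorem primrecPred_interior_inter {f g : α → ℕ} (hf : Primrec f) (hg : Primrec g) :
    PrimrecPred fun a => (interior (intervalBasis n (f a)).carrier ∩
      interior (intervalBasis n (g a)).carrier).Nonempty := by
  have hne : ∀ {β : Type _} [Primcodable β] {h : β → ℕ}, Primrec h → PrimrecPred fun b =>
      (interior (intervalBasis n (h b)).carrier).Nonempty := by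
    intro β _ h hh
    refine primrecPred_of_cases
      (p := fun (_ : β) i => (interior (intervalBasis n i).carrier).Nonempty) hh
      (primrecPred_const True) (r := fun _ k => (interior (ratBox n k) ∩
        interior (ratBox n k)).Nonempty) ?_ (fun b => ?_) fun b k => ?_
    · exact primrecPred_interior_ratBox_inter Primrec.snd Primrec.snd
    · simp [intervalBasis_zero]
    · rw [carrier_intervalBasis_succ, Set.inter_self]
  refine primrecPred_of_cases (p := fun a i => (interior (intervalBasis n i).carrier ∩
      interior (intervalBasis n (g a)).carrier).Nonempty) hf (hne hg)
      (r := fun a k => (interior (ratBox n k) ∩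
        interior (intervalBasis n (g a)).carrier).Nonempty) ?_ (fun a => ?_) fun a k => ?_
  · refine primrecPred_of_cases (p := fun (x : α × ℕ) i => (interior (ratBox n x.2) ∩
      interior (intervalBasis n i).carrier).Nonempty) (hg.comp Primrec.fst)
      (q := fun x => (interior (intervalBasis n (x.2 + 1)).carrier).Nonempty)
      (hne (Primrec.succ.comp Primrec.snd))
      (r := fun x k => (interior (ratBox n x.2) ∩ interior (ratBox n k)).Nonempty) ?_
      (fun a => ?_) fun a k => ?_
    · exact primrecPred_interior_ratBox_inter (Primrec.snd.comp Primrec.fst) Primrec.snd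
    · simp [intervalBasis_zero, carrier_intervalBasis_succ]
    · rw [carrier_intervalBasis_succ]
  · simp [intervalBasis_zero]
  · rw [carrier_intervalBasis_succ]

theorem primrecPred_carrier_inter {f g : α → ℕ} (hf : Primrec f) (hg : Primrec g) :
    PrimrecPred fun a => ((intervalBasis n (f a)).carrier ∩
      (intervalBasis n (g a)).carrier).Nonempty := by
  refine primrecPred_of_cases (p := fun a i => ((intervalBasis n i).carrier ∩
      (intervalBasis n (g a)).carrier).Nonempty) hf (primrecPred_const True)
      (r := fun a k => (ratBox n k ∩
        (intervalBasis n (g a)).carrier).Nonempty) ?_ (fun a => ?_) fun a k => ?_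
  · refine primrecPred_of_cases (p := fun (x : α × ℕ) i => (ratBox n x.2 ∩
      (intervalBasis n i).carrier).Nonempty) (hg.comp Primrec.fst)
      (primrecPred_const True)
      (r := fun x k => (ratBox n x.2 ∩ ratBox n k).Nonempty) ?_ (fun a => ?_) fun a k => ?_
    · have h1 : Primrec fun x : ((α × ℕ) × ℕ) × ℕ => x.1.1.2 :=
        Primrec.snd.comp (Primrec.fst.comp Primrec.fst)
      have h2 : Primrec fun x : ((α × ℕ) × ℕ) × ℕ => x.1.2 := Primrec.snd.comp Primrec.fst
      refine (primrecPred_forall_fin n ((primrecPred_codeReal_le (primrec_lowerCode h1 Primrec.snd)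
        (primrec_upperCode h2 Primrec.snd)).and (primrecPred_codeReal_le
          (primrec_lowerCode h2 Primrec.snd)
          (primrec_upperCode h1 Primrec.snd))).primrecRel).of_eq fun x => ?_
      dsimp only
      rw [ratBox_eq, ratBox_eq, Set.Icc_inter_Icc, Set.nonempty_Icc, Pi.le_def]
      refine forall_congr' fun i => ?_
      simp only [Pi.sup_apply, Pi.inf_apply, sup_le_iff, le_inf_iff, lowerCode_le_upperCode,
        true_and, and_true]
      exact and_comm
    · simp [intervalBasis_zero, (isHyperbox_ratBox _).nonempty]
    · rw [carrier_intervalBasis_succ]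
  · simp [intervalBasis_zero, IntervalDomain.nonempty]
  · rw [carrier_intervalBasis_succ]

theorem primrecPred_ratBox_inter_interior {f g : α → ℕ} (hf : Primrec f) (hg : Primrec g) :
    PrimrecPred fun a => (ratBox n (f a) ∩ interior (intervalBasis n (g a)).carrier).Nonempty := by
  refine primrecPred_of_cases (p := fun a i => (ratBox n (f a) ∩
      interior (intervalBasis n i).carrier).Nonempty) hg (primrecPred_const True)
      (r := fun a k => (ratBox n (f a) ∩ interior (ratBox n k)).Nonempty) ?_
      (fun a => ?_) fun a k => ?_
  · have h1 : Primrec fun x : (α × ℕ) × ℕ => f x.1.1 := hf.comp (Primrec.fst.comp Primrec.fst)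
    have h2 : Primrec fun x : (α × ℕ) × ℕ => x.1.2 := Primrec.snd.comp Primrec.fst
    have hl1 := primrec_lowerCode h1 Primrec.snd
    have hl2 := primrec_lowerCode h2 Primrec.snd
    have hu1 := primrec_upperCode h1 Primrec.snd
    have hu2 := primrec_upperCode h2 Primrec.snd
    refine (primrecPred_forall_fin n ((primrecPred_codeReal_lt hl1 hu2).and
      ((primrecPred_codeReal_lt hl2 hu1).and
        (primrecPred_codeReal_lt hl2 hu2))).primrecRel).of_eq fun x => ?_
    dsimp only
    rw [ratBox_eq, ratBox_eq, Icc_inter_interior_nonempty fun i => lowerCode_le_upperCode _ _]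
  · simp [intervalBasis_zero, (isHyperbox_ratBox _).nonempty]
  · rw [carrier_intervalBasis_succ]

end Codes

/-! ### Effective evaluation of step functions -/

section Steps

variable {α : Type*} [Primcodable α] {n : ℕ}

theorem primrecPred_consistentSteps (n : ℕ) : PrimrecPred fun j => ConsistentSteps (stepList n j) := by
  have hp : PrimrecPred fun x : (ℕ × (ℕ × ℕ)) × (ℕ × ℕ) =>
      (interior (intervalBasis n x.1.2.1).carrier ∩
        interior (intervalBasis n x.2.1).carrier).Nonempty →
      ((intervalBasis 1 x.1.2.2).carrier ∩ (intervalBasis 1 x.2.2).carrier).Nonempty := by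
    have h1 : Primrec fun x : (ℕ × (ℕ × ℕ)) × (ℕ × ℕ) => x.1.2 := Primrec.snd.comp Primrec.fst
    have h2 : Primrec fun x : (ℕ × (ℕ × ℕ)) × (ℕ × ℕ) => x.2 := Primrec.snd
    exact (primrecPred_interior_inter (Primrec.fst.comp h1) (Primrec.fst.comp h2)).imp
      (primrecPred_carrier_inter (Primrec.snd.comp h1) (Primrec.snd.comp h2))
  have hL := Primrec.ofNat (List (ℕ × ℕ))
  refine (PrimrecPred.forall_mem hL (PrimrecPred.forall_mem
    (hL.comp Primrec.fst) hp.primrecRel).primrecRel).of_eq fun j => ?_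
  simp only [ConsistentSteps, stepList, List.forall_mem_map]

/-- The steps with code `j` if they are consistent, and no steps otherwise. -/
noncomputable def effectiveSteps (n j : ℕ) : List (ℕ × ℕ) :=
  open Classical in
  if ConsistentSteps (stepList n j) then Denumerable.ofNat (List (ℕ × ℕ)) j else []

theorem primrec_effectiveSteps (n : ℕ) : Primrec (effectiveSteps n) := by
  classical
  exact (Primrec.ite (primrecPred_consistentSteps n) (Primrec.ofNat (List (ℕ × ℕ)))
    (Primrec.const [])).of_eq fun j => by unfold effectiveSteps; congr

/-- The steps with the given codes. -/
noncomputable def decodeSteps (n : ℕ) (L : List (ℕ × ℕ)) :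
    List (IntervalDomain n × IntervalDomain 1) :=
  L.map fun w => (intervalBasis n w.1, intervalBasis 1 w.2)

theorem consistentSteps_effectiveSteps (j : ℕ) :
    ConsistentSteps (decodeSteps n (effectiveSteps n j)) := by
  unfold effectiveSteps
  split_ifs with h
  · exact h
  · exact consistentSteps_nil

theorem stepBasis_eq_effectiveSteps (j : ℕ) :
    stepBasis n j = stepFunction (decodeSteps n (effectiveSteps n j)) := by
  unfold effectiveSteps
  split_ifs with h
  · rfl
  · exact stepFunction_of_not_consistentSteps h

theorem mem_carrier_stepBasis (j : ℕ) (x : IntervalDomain n) (t : Fin 1 → ℝ) :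
    t ∈ ((stepBasis n j).1 x).carrier ↔ ∀ w ∈ effectiveSteps n j,
      WayBelow (intervalBasis n w.1) x → t ∈ (intervalBasis 1 w.2).carrier := by
  rw [stepBasis_eq_effectiveSteps, (consistentSteps_effectiveSteps j).mem_carrier]
  simp only [decodeSteps, List.forall_mem_map]

/-- Index `0` is the whole line and index `k + 1` is the box with code `k`, whence the predecessor.
-/
theorem intervalBasis_subset_above_iff (i : ℕ) (r : ℝ) :
    (intervalBasis 1 i).carrier ⊆ above r ↔ i ≠ 0 ∧ r < codeReal (lowerCode i.pred 0) := by
  rcases i with _ | k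
  · simpa [intervalBasis_zero] using
      fun h : Set.univ ⊆ above r => lt_irrefl r (h (Set.mem_univ fun _ => r))
  · rw [carrier_intervalBasis_succ, ratBox_eq]
    simp only [ne_eq, Nat.succ_ne_zero, not_false_eq_true, true_and, Nat.pred_succ]
    constructor
    · intro h
      exact h (Set.left_mem_Icc.2 fun i => lowerCode_le_upperCode _ _)
    · intro h t ht
      exact h.trans_le (ht.1 0)

theorem intervalBasis_subset_below_iff (i : ℕ) (r : ℝ) :
    (intervalBasis 1 i).carrier ⊆ below r ↔ i ≠ 0 ∧ codeReal (upperCode i.pred 0) < r := by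
  rcases i with _ | k
  · simpa [intervalBasis_zero] using
      fun h : Set.univ ⊆ below r => lt_irrefl r (h (Set.mem_univ fun _ => r))
  · rw [carrier_intervalBasis_succ, ratBox_eq]
    simp only [ne_eq, Nat.succ_ne_zero, not_false_eq_true, true_and, Nat.pred_succ]
    constructor
    · intro h
      exact h (Set.right_mem_Icc.2 fun i => lowerCode_le_upperCode _ _)
    · intro h t ht
      exact (ht.2 0).trans_lt h

/-- An intersection of intervals lies above `r` only if one of them does: otherwise a common point
`t` can be lowered to `min t r` without leaving any of them. -/
theorem stepBasis_subset_above_iff (j : ℕ) (x : IntervalDomain n) (r : ℝ) :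
    ((stepBasis n j).1 x).carrier ⊆ above r ↔ ∃ w ∈ effectiveSteps n j,
      WayBelow (intervalBasis n w.1) x ∧ (intervalBasis 1 w.2).carrier ⊆ above r := by
  constructor
  · intro h
    by_contra! hno
    obtain ⟨t, ht⟩ := ((stepBasis n j).1 x).nonempty
    have hs : (fun _ => min (t 0) r) ∈ ((stepBasis n j).1 x).carrier := by
      rw [mem_carrier_stepBasis] at ht ⊢
      intro w hw hwx
      have htw := ht w hw hwx
      have hr := hno w hw hwx
      rcases (intervalBasis 1 w.2).isBox with hI | ⟨p, q, -, hI⟩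
      · rw [hI]; trivial
      · rw [hI] at htw hr ⊢
        rw [mem_Icc_pi] at htw ⊢
        intro i
        obtain rfl := Subsingleton.elim i 0
        have hpr : p 0 ≤ r := by
          by_contra hlt
          exact hr fun t ht => (not_le.1 hlt).trans_le (ht.1 0)
        exact ⟨le_min (htw 0).1 hpr, (min_le_left _ _).trans (htw 0).2⟩
    exact (min_le_right (t 0) r).not_gt (h hs)
  · rintro ⟨w, hw, hwx, h⟩ t ht
    exact h ((mem_carrier_stepBasis j x t).1 ht w hw hwx)

theorem stepBasis_subset_below_iff (j : ℕ) (x : IntervalDomain n) (r : ℝ) :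
    ((stepBasis n j).1 x).carrier ⊆ below r ↔ ∃ w ∈ effectiveSteps n j,
      WayBelow (intervalBasis n w.1) x ∧ (intervalBasis 1 w.2).carrier ⊆ below r := by
  constructor
  · intro h
    by_contra! hno
    obtain ⟨t, ht⟩ := ((stepBasis n j).1 x).nonempty
    have hs : (fun _ => max (t 0) r) ∈ ((stepBasis n j).1 x).carrier := by
      rw [mem_carrier_stepBasis] at ht ⊢
      intro w hw hwx
      have htw := ht w hw hwx
      have hr := hno w hw hwx
      rcases (intervalBasis 1 w.2).isBox with hI | ⟨p, q, -, hI⟩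
      · rw [hI]; trivial
      · rw [hI] at htw hr ⊢
        rw [mem_Icc_pi] at htw ⊢
        intro i
        obtain rfl := Subsingleton.elim i 0
        have hqr : r ≤ q 0 := by
          by_contra hlt
          exact hr fun t ht => (ht.2 0).trans_lt (not_le.1 hlt)
        exact ⟨(htw 0).1.trans (le_max_left _ _), max_le (htw 0).2 hqr⟩
    exact (le_max_right (t 0) r).not_gt (h hs)
  · rintro ⟨w, hw, hwx, h⟩ t ht
    exact h ((mem_carrier_stepBasis j x t).1 ht w hw hwx)

theorem primrecPred_subset_above {f g : α → ℕ} (hf : Primrec f) (hg : Primrec g) :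
    PrimrecPred fun a => (intervalBasis 1 (f a)).carrier ⊆ above (codeReal (g a)) :=
  ((PrimrecRel.comp Primrec.eq hf (Primrec.const 0)).not.and (primrecPred_codeReal_lt hg
    (primrec_lowerCode (Primrec.pred.comp hf) (Primrec.const 0)))).of_eq fun _ =>
      (intervalBasis_subset_above_iff _ _).symm

theorem primrecPred_subset_below {f g : α → ℕ} (hf : Primrec f) (hg : Primrec g) :
    PrimrecPred fun a => (intervalBasis 1 (f a)).carrier ⊆ below (codeReal (g a)) :=
  ((PrimrecRel.comp Primrec.eq hf (Primrec.const 0)).not.and (primrecPred_codeReal_lt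
    (primrec_upperCode (Primrec.pred.comp hf) (Primrec.const 0)) hg)).of_eq fun _ =>
      (intervalBasis_subset_below_iff _ _).symm

theorem interior_ratBox_one (k : ℕ) : interior (ratBox 1 k) =
    above (codeReal (lowerCode k 0)) ∩ below (codeReal (upperCode k 0)) := by
  rw [ratBox_eq, interior_Icc_eq]
  rfl

theorem primrecPred_wayBelow_stepBasis_apply (hn : 1 ≤ n) {f g h : α → ℕ} (hf : Primrec f)
    (hg : Primrec g) (hh : Primrec h) : PrimrecPred fun a =>
      WayBelow (intervalBasis 1 (f a)) ((stepBasis n (g a)).1 (intervalBasis n (h a))) := by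
  refine primrecPred_of_cases (p := fun a i => WayBelow (intervalBasis 1 i)
    ((stepBasis n (g a)).1 (intervalBasis n (h a)))) hf (primrecPred_const True)
    (r := fun a k =>
      (∃ w ∈ effectiveSteps n (g a), WayBelow (intervalBasis n w.1) (intervalBasis n (h a)) ∧
        (intervalBasis 1 w.2).carrier ⊆ above (codeReal (lowerCode k 0))) ∧
      (∃ w ∈ effectiveSteps n (g a), WayBelow (intervalBasis n w.1) (intervalBasis n (h a)) ∧
        (intervalBasis 1 w.2).carrier ⊆ below (codeReal (upperCode k 0)))) ?_
    (fun a => ?_) fun a k => ?_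
  · have hL : Primrec fun x : α × ℕ => effectiveSteps n (g x.1) :=
      (primrec_effectiveSteps n).comp (hg.comp Primrec.fst)
    have hk : Primrec fun x : (α × ℕ) × (ℕ × ℕ) => x.1.2 := Primrec.snd.comp Primrec.fst
    have hx : Primrec fun x : (α × ℕ) × (ℕ × ℕ) => h x.1.1 :=
      hh.comp (Primrec.fst.comp Primrec.fst)
    have hw := primrecPred_wayBelow_interval hn (Primrec.fst.comp (Primrec.snd (α := α × ℕ))) hx
    have he := Primrec.snd.comp (Primrec.snd (α := α × ℕ) (β := ℕ × ℕ))
    exact PrimrecPred.and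
      (PrimrecPred.exists_mem hL (hw.and (primrecPred_subset_above he
        (primrec_lowerCode hk (Primrec.const 0)))).primrecRel)
      (PrimrecPred.exists_mem hL (hw.and (primrecPred_subset_below he
        (primrec_upperCode hk (Primrec.const 0)))).primrecRel)
  · rw [wayBelow_interval, intervalBasis_zero]
    simp
  · rw [wayBelow_interval, carrier_intervalBasis_succ, interior_ratBox_one, Set.subset_inter_iff,
      stepBasis_subset_above_iff, stepBasis_subset_below_iff]

/-- Nonempty interior is written as a self-intersection, the form decided by
`primrecPred_interior_inter`. -/
theorem wayBelow_stepBasis_iff (i j : ℕ) : WayBelow (stepBasis n i) (stepBasis n j) ↔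
    ∀ w ∈ effectiveSteps n i, (interior (intervalBasis n w.1).carrier ∩
        interior (intervalBasis n w.1).carrier).Nonempty →
      WayBelow (intervalBasis 1 w.2) ((stepBasis n j).1 (intervalBasis n w.1)) := by
  rw [stepBasis_eq_effectiveSteps i, wayBelow_stepFunction_iff (consistentSteps_effectiveSteps i)]
  simp only [StepsBelow, decodeSteps, List.forall_mem_map, Set.inter_self,
    Set.nonempty_iff_ne_empty, ne_eq, or_iff_not_imp_left]

theorem primrecPred_wayBelow_stepBasis (hn : 1 ≤ n) :
    PrimrecPred fun p : ℕ × ℕ => WayBelow (stepBasis n p.1) (stepBasis n p.2) := by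
  have hd := Primrec.fst.comp (Primrec.snd (α := ℕ × ℕ) (β := ℕ × ℕ))
  have he := Primrec.snd.comp (Primrec.snd (α := ℕ × ℕ) (β := ℕ × ℕ))
  exact (PrimrecPred.forall_mem ((primrec_effectiveSteps n).comp Primrec.fst)
    ((primrecPred_interior_inter hd hd).imp (primrecPred_wayBelow_stepBasis_apply hn he
      (Primrec.snd.comp Primrec.fst) hd)).primrecRel).of_eq fun p =>
        (wayBelow_stepBasis_iff p.1 p.2).symm

/-! ### Effective covers -/

/-- A number between elements of `A` either equals one of them or lies in the gap between two
neighbours `l` and `u`; `S` has a representative in each case, with the same comparisons to all of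
`A`. -/
theorem exists_sample {A S : List ℕ} (hAS : A ⊆ S)
    (hS : ∀ a ∈ A, ∀ b ∈ A, codeReal a < codeReal b →
      ∃ s ∈ S, codeReal a < codeReal s ∧ codeReal s < codeReal b)
    {t : ℝ} (hl : ∃ a ∈ A, codeReal a ≤ t) (hu : ∃ a ∈ A, t ≤ codeReal a) :
    ∃ s ∈ S, ∀ a ∈ A, (codeReal a ≤ t ↔ codeReal a ≤ codeReal s) ∧
      (t ≤ codeReal a ↔ codeReal s ≤ codeReal a) := by
  classical
  by_cases ht : ∃ a ∈ A, codeReal a = t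
  · obtain ⟨a, ha, rfl⟩ := ht
    exact ⟨a, hAS ha, fun _ _ => ⟨Iff.rfl, Iff.rfl⟩⟩
  push Not at ht
  obtain ⟨a, ha, hat⟩ := hl
  obtain ⟨b, hb, hbt⟩ := hu
  obtain ⟨l, hl, hlmax⟩ := Finset.exists_max_image (A.toFinset.filter fun a => codeReal a < t)
    codeReal ⟨a, by simpa [ha] using lt_of_le_of_ne hat (ht a ha)⟩
  obtain ⟨u, hu, humin⟩ := Finset.exists_min_image (A.toFinset.filter fun a => t < codeReal a)
    codeReal ⟨b, by simpa [hb] using lt_of_le_of_ne hbt (ht b hb).symm⟩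
  simp only [Finset.mem_filter, List.mem_toFinset, and_imp] at hl hu hlmax humin
  obtain ⟨s, hs, hls, hsu⟩ := hS l hl.1 u hu.1 (hl.2.trans hu.2)
  refine ⟨s, hs, fun c hc => ?_⟩
  rcases lt_or_gt_of_ne (ht c hc) with h | h
  · have := (hlmax c hc h).trans_lt hls
    exact ⟨iff_of_true h.le this.le, iff_of_false h.not_ge this.not_ge⟩
  · have := hsu.trans_le (humin c hc h)
    exact ⟨iff_of_false h.not_ge this.not_ge, iff_of_true h.le this.le⟩

/-- The word `w` of codes of real numbers lies in the box with code `k`. -/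
def InBox (n k : ℕ) (w : List ℕ) : Prop :=
  ∀ i : Fin n, codeReal (lowerCode k i) ≤ codeReal (w.getD i 0) ∧
    codeReal (w.getD i 0) ≤ codeReal (upperCode k i)

theorem inBox_iff (k : ℕ) (w : List ℕ) :
    InBox n k w ↔ (fun i : Fin n => codeReal (w.getD i 0)) ∈ ratBox n k := by
  rw [ratBox_eq, mem_Icc_pi]
  rfl

/-- `S` witnesses, by the points with coordinates in `S`, that the boxes with codes in `P` are
covered by those with codes in `Q`; the list `A` contains the ends of the sides of all boxes. -/
def CoverWitness (n : ℕ) (A S P Q : List ℕ) : Prop :=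
  (∀ k ∈ P ++ Q, ∀ i : Fin n, lowerCode k i ∈ A ∧ upperCode k i ∈ A) ∧ (∀ a ∈ A, a ∈ S) ∧
  (∀ a ∈ A, ∀ b ∈ A, codeReal a < codeReal b →
    ∃ s ∈ S, codeReal a < codeReal s ∧ codeReal s < codeReal b) ∧
  ∀ w : List ℕ, w.length = n → (∀ s ∈ w, s ∈ S) → (∃ k ∈ P, InBox n k w) → ∃ k ∈ Q, InBox n k w

/-- Membership in a box depends only on how the coordinates compare with its ends, so any point can
be replaced by a sample point lying in the same boxes. -/
theorem exists_coverWitness_iff (P Q : List ℕ) : (∃ A S, CoverWitness n A S P Q) ↔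
    ⋃ k ∈ P, ratBox n k ⊆ ⋃ k ∈ Q, ratBox n k := by
  constructor
  · rintro ⟨A, S, hA, hAS, hS, hw⟩ x hx
    obtain ⟨k, hk, hxk⟩ := Set.mem_iUnion₂.1 hx
    have hAk := hA k (List.mem_append_left _ hk)
    have hxk' := hxk
    rw [ratBox_eq, mem_Icc_pi] at hxk'
    choose s hs hsA using fun i : Fin n => exists_sample hAS hS (t := x i)
      ⟨_, (hAk i).1, (hxk' i).1⟩ ⟨_, (hAk i).2, (hxk' i).2⟩
    have key : ∀ l ∈ P ++ Q, InBox n l (List.ofFn s) ↔ x ∈ ratBox n l := by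
      intro l hl
      rw [ratBox_eq, mem_Icc_pi]
      refine forall_congr' fun i => ?_
      have : (List.ofFn s).getD i 0 = s i := by simp [List.getD]
      rw [this, (hsA i _ (hA l hl i).1).1, (hsA i _ (hA l hl i).2).2]
    obtain ⟨l, hl, hwl⟩ := hw (List.ofFn s) (by simp)
      (by simpa [List.mem_ofFn] using hs)
      ⟨k, hk, (key k (List.mem_append_left _ hk)).2 hxk⟩
    exact Set.mem_biUnion hl ((key l (List.mem_append_right _ hl)).1 hwl)
  · intro h
    have hmid : ∀ a b : ℕ, ∃ s, codeReal a < codeReal b →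
        codeReal a < codeReal s ∧ codeReal s < codeReal b := by
      intro a b
      by_cases hab : codeReal a < codeReal b
      · obtain ⟨q, hq⟩ := exists_rat_btwn hab
        obtain ⟨s, rfl⟩ := ratOfNat_surjective q
        exact ⟨s, fun _ => hq⟩
      · exact ⟨0, fun h => absurd h hab⟩
    choose m hm using hmid
    let A : List ℕ := (P ++ Q).flatMap fun k =>
      (List.finRange n).flatMap fun i => [lowerCode k i, upperCode k i]
    -- The samples are all ends of sides and one rational between any two different ends.
    refine ⟨A, A ++ A.flatMap fun a => A.map (m a), ?_, ?_, ?_, ?_⟩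
    · intro k hk i
      constructor <;> refine List.mem_flatMap.2 ⟨k, hk, List.mem_flatMap.2 ⟨i, by simp, by simp⟩⟩
    · exact fun a ha => List.mem_append_left _ ha
    · exact fun a ha b hb hab => ⟨m a b, List.mem_append_right _
        (List.mem_flatMap.2 ⟨a, ha, List.mem_map_of_mem hb⟩), hm a b hab⟩
    · rintro w - - ⟨k, hk, hkw⟩
      obtain ⟨l, hl, hlw⟩ := Set.mem_iUnion₂.1 (h (Set.mem_biUnion hk ((inBox_iff k w).1 hkw)))
      exact ⟨l, hl, (inBox_iff l w).2 hlw⟩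

theorem primrecPred_inBox {f : α → ℕ} {g : α → List ℕ} (hf : Primrec f) (hg : Primrec g) :
    PrimrecPred fun a => InBox n (f a) (g a) := by
  have hw : Primrec fun x : α × ℕ => (g x.1).getD x.2 0 :=
    (Primrec.list_getD 0).comp (hg.comp Primrec.fst) Primrec.snd
  exact primrecPred_forall_fin n ((primrecPred_codeReal_le
    (primrec_lowerCode (hf.comp Primrec.fst) Primrec.snd) hw).and
    (primrecPred_codeReal_le hw (primrec_upperCode (hf.comp Primrec.fst) Primrec.snd))).primrecRel

theorem primrecPred_mem {β : Type*} [Primcodable β] {f : α → β} {g : α → List β}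
    (hf : Primrec f) (hg : Primrec g) : PrimrecPred fun a => f a ∈ g a :=
  (PrimrecPred.exists_mem hg (PrimrecRel.comp Primrec.eq Primrec.snd
    (hf.comp Primrec.fst)).primrecRel).of_eq fun a => by simp

theorem primrecPred_coverWitness {A S P Q : α → List ℕ} (hA : Primrec A) (hS : Primrec S)
    (hP : Primrec P) (hQ : Primrec Q) :
    PrimrecPred fun a => CoverWitness n (A a) (S a) (P a) (Q a) := by
  refine PrimrecPred.and ?_ (PrimrecPred.and ?_ (PrimrecPred.and ?_ ?_))
  · have hx : Primrec fun x : (α × ℕ) × ℕ => x.1.2 := Primrec.snd.comp Primrec.fst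
    have hA' : Primrec fun x : (α × ℕ) × ℕ => A x.1.1 := hA.comp (Primrec.fst.comp Primrec.fst)
    exact PrimrecPred.forall_mem (Primrec.list_append.comp hP hQ)
      (primrecPred_forall_fin n ((primrecPred_mem (primrec_lowerCode hx Primrec.snd) hA').and
        (primrecPred_mem (primrec_upperCode hx Primrec.snd) hA')).primrecRel).primrecRel
  · exact PrimrecPred.forall_mem hA (primrecPred_mem Primrec.snd (hS.comp Primrec.fst)).primrecRel
  · have ha : Primrec fun x : (α × ℕ) × ℕ => x.1.2 := Primrec.snd.comp Primrec.fst
    have ha' : Primrec fun x : ((α × ℕ) × ℕ) × ℕ => x.1.1.2 := ha.comp Primrec.fst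
    have hb' : Primrec fun x : ((α × ℕ) × ℕ) × ℕ => x.1.2 := Primrec.snd.comp Primrec.fst
    exact PrimrecPred.forall_mem hA (PrimrecPred.forall_mem (hA.comp Primrec.fst)
      ((primrecPred_codeReal_lt ha Primrec.snd).imp (PrimrecPred.exists_mem
        (hS.comp (Primrec.fst.comp Primrec.fst))
        ((primrecPred_codeReal_lt ha' Primrec.snd).and
          (primrecPred_codeReal_lt Primrec.snd hb')).primrecRel)).primrecRel).primrecRel
  · have hw : Primrec fun x : (α × List ℕ) × ℕ => x.1.2 := Primrec.snd.comp Primrec.fst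
    have hin := (primrecPred_inBox (n := n) Primrec.snd hw).primrecRel
    exact primrecPred_forall_words n hS
      (PrimrecPred.imp (PrimrecPred.exists_mem (hP.comp Primrec.fst) hin)
        (PrimrecPred.exists_mem (hQ.comp Primrec.fst) hin)).primrecRel

end Steps

/-! ### Semidecidability of covers by open sets -/

section Covers

variable {α : Type*} [Primcodable α] {n : ℕ}

/-- The boxes with codes in `P` are covered by the interior of the union of those with codes in
`C` and the interiors of the basis elements with indices in `O`. -/
def OpenCover (n : ℕ) (P C O : List ℕ) : Prop :=
  ⋃ k ∈ P, ratBox n k ⊆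
    interior (⋃ k ∈ C, ratBox n k) ∪ ⋃ o ∈ O, interior (intervalBasis n o).carrier

/-- By compactness an open cover has room: the boxes of `P` can be enlarged to `P'` and the open
regions shrunk to closed boxes `O'`, leaving an inclusion of closed sets. -/
theorem openCover_iff (P C O : List ℕ) : OpenCover n P C O ↔
    ∃ P' O' : List ℕ, (∀ k ∈ P, ∃ k' ∈ P', ratBox n k ⊆ interior (ratBox n k')) ∧
      (∀ k ∈ O', ∃ o ∈ O, WayBelow (intervalBasis n o) (intervalBasis n (k + 1))) ∧
      ⋃ k ∈ P', ratBox n k ⊆ ⋃ k ∈ C ++ O', ratBox n k := by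
  simp only [wayBelow_interval, carrier_intervalBasis_succ]
  constructor
  · intro h
    obtain ⟨O', hO', hO⟩ := exists_ratBoxes_between
      ((isCompact_ratBoxes P).diff (isOpen_interior (s := ⋃ k ∈ C, ratBox n k)))
      (𝒰 := {U | ∃ o ∈ O, interior (intervalBasis n o).carrier = U})
      (by
        rintro _ ⟨o, -, rfl⟩
        exact isOpen_interior)
      (by
        rintro x ⟨hx, hxC⟩
        obtain ⟨o, ho, hxo⟩ := Set.mem_iUnion₂.1 ((h hx).resolve_left hxC)
        exact ⟨_, ⟨o, ho, rfl⟩, hxo⟩)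
    have hP : ∀ k ∈ P, ratBox n k ⊆
        interior (⋃ k ∈ C, ratBox n k) ∪ ⋃ o ∈ O', interior (ratBox n o) := by
      intro k hk x hx
      by_cases hxC : x ∈ interior (⋃ k ∈ C, ratBox n k)
      · exact Or.inl hxC
      · obtain ⟨o, ho, hxo⟩ := hO' x ⟨Set.mem_biUnion hk hx, hxC⟩
        exact Or.inr (Set.mem_biUnion ho hxo)
    choose! g hg1 hg2 using fun k hk => exists_ratBox_between (isHyperbox_ratBox k)
      (isOpen_interior.union (isOpen_biUnion fun _ _ => isOpen_interior)) (hP k hk)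
    refine ⟨P.map g, O', fun k hk => ⟨g k, List.mem_map_of_mem hk, hg1 k hk⟩, fun k hk => ?_, ?_⟩
    · obtain ⟨_, ⟨o, ho, rfl⟩, hko⟩ := hO k hk
      exact ⟨o, ho, hko⟩
    · refine Set.iUnion₂_subset fun k' hk' => ?_
      obtain ⟨k, hk, rfl⟩ := List.mem_map.1 hk'
      refine (hg2 k hk).trans (Set.union_subset (interior_subset.trans ?_) ?_)
      · exact Set.biUnion_subset_biUnion_left fun k hk => List.mem_append_left _ hk
      · exact Set.iUnion₂_subset fun o ho => interior_subset.trans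
          (Set.subset_biUnion_of_mem (u := fun k => ratBox n k) (List.mem_append_right C ho))
  · rintro ⟨P', O', hP, hO, hcov⟩ x hx
    obtain ⟨k, hk, hxk⟩ := Set.mem_iUnion₂.1 hx
    obtain ⟨k', hk', hkk'⟩ := hP k hk
    by_cases hxO : ∃ o ∈ O', x ∈ ratBox n o
    · obtain ⟨o', ho', hxo'⟩ := hxO
      obtain ⟨o, ho, hoo'⟩ := hO o' ho'
      exact Or.inr (Set.mem_biUnion ho (hoo' hxo'))
    · left
      -- Off the closed boxes `O'`, this open neighbourhood of `x` must be covered by `C` alone, so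
      -- `x` is interior to the union of `C`.
      have hopen : IsOpen (interior (ratBox n k') \ ⋃ o ∈ O', ratBox n o) :=
        isOpen_interior.sdiff (isCompact_ratBoxes O').isClosed
      refine interior_maximal ?_ hopen ⟨hkk' hxk, by simpa using hxO⟩
      rintro y ⟨hy, hyO⟩
      obtain ⟨l, hl, hyl⟩ := Set.mem_iUnion₂.1
        (hcov (Set.mem_biUnion hk' (interior_subset hy)))
      rcases List.mem_append.1 hl with hl | hl
      · exact Set.mem_biUnion hl hyl
      · exact absurd (Set.mem_iUnion₂.2 ⟨l, hl, hyl⟩) hyO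

theorem primrec_decodeList {f : α → ℕ} (hf : Primrec f) :
    Primrec fun a => Denumerable.ofNat (List ℕ) (f a) :=
  (Primrec.ofNat (List ℕ)).comp hf

theorem exists_list_iff {p : List ℕ → Prop} :
    (∃ l, p l) ↔ ∃ k, p (Denumerable.ofNat (List ℕ) k) :=
  (Denumerable.eqv (List ℕ)).symm.surjective.exists

theorem isSigmaOne_exists_coverWitness {P Q : α → List ℕ} (hP : Primrec P) (hQ : Primrec Q) :
    IsSigmaOne fun a => ∃ A S, CoverWitness n A S (P a) (Q a) := by
  simp only [exists_list_iff]
  refine IsSigmaOne.exists_nat (IsSigmaOne.exists_nat (PrimrecPred.isSigmaOne ?_))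
  exact primrecPred_coverWitness (primrec_decodeList (Primrec.snd.comp Primrec.fst))
    (primrec_decodeList Primrec.snd) (hP.comp (Primrec.fst.comp Primrec.fst))
    (hQ.comp (Primrec.fst.comp Primrec.fst))

theorem isSigmaOne_openCover (hn : 1 ≤ n) {P C O : α → List ℕ} (hP : Primrec P) (hC : Primrec C)
    (hO : Primrec O) : IsSigmaOne fun a => OpenCover n (P a) (C a) (O a) := by
  simp only [openCover_iff, exists_list_iff, ← exists_coverWitness_iff]
  refine IsSigmaOne.exists_nat (IsSigmaOne.exists_nat (IsSigmaOne.and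
    (PrimrecPred.isSigmaOne ?_) (IsSigmaOne.and (PrimrecPred.isSigmaOne ?_) ?_)))
  · exact PrimrecPred.forall_mem (hP.comp (Primrec.fst.comp Primrec.fst))
      (PrimrecPred.exists_mem
        (primrec_decodeList (Primrec.snd.comp (Primrec.fst.comp Primrec.fst)))
        (primrecPred_ratBox_subset_interior Primrec.snd
          (Primrec.snd.comp Primrec.fst)).primrecRel).primrecRel
  · exact PrimrecPred.forall_mem (primrec_decodeList Primrec.snd)
      (PrimrecPred.exists_mem
        (hO.comp (Primrec.fst.comp (Primrec.fst.comp Primrec.fst)))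
        (primrecPred_wayBelow_interval hn Primrec.snd
          (Primrec.succ.comp (Primrec.snd.comp Primrec.fst))).primrecRel).primrecRel
  · have h := isSigmaOne_exists_coverWitness (n := n) (primrec_decodeList (Primrec.snd.comp Primrec.fst))
      (Primrec.list_append.comp (hC.comp (Primrec.fst.comp Primrec.fst))
        (primrec_decodeList Primrec.snd))
    simpa only [exists_list_iff] using h

theorem isSigmaOne_of_cases {p : α → ℕ → Prop} {q : α → Prop} {r : α → ℕ → Prop} {f : α → ℕ}
    (hf : Primrec f) (hq : IsSigmaOne q) (hr : IsSigmaOne fun x : α × ℕ => r x.1 x.2)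
    (h0 : ∀ a, p a 0 ↔ q a) (h1 : ∀ a k, p a (k + 1) ↔ r a k) :
    IsSigmaOne fun a => p a (f a) := by
  have hz : PrimrecPred fun a => f a = 0 := PrimrecRel.comp Primrec.eq hf (Primrec.const 0)
  refine ((hz.isSigmaOne.and hq).or (hz.not.isSigmaOne.and
    (hr.comp (Primrec.id.pair (Primrec.pred.comp hf))))).of_eq fun a => ?_
  rcases f a with _ | k
  · simp [h0]
  · simp [h1]

theorem primrec_boxList {f : α → ℕ} (hf : Primrec f) : Primrec fun a => boxList (f a) :=
  Primrec.list_cons.comp (Primrec.fst.comp (Primrec.unpair.comp hf))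
    (primrec_decodeList (Primrec.snd.comp (Primrec.unpair.comp hf)))

theorem rePred_wayBelow_compactBasis (hn : 1 ≤ n) :
    REPred fun p : ℕ × ℕ => WayBelow (compactBasis n p.1) (compactBasis n p.2) := by
  refine IsSigmaOne.rePred (isSigmaOne_of_cases (p := fun (a : ℕ × ℕ) i =>
    WayBelow (compactBasis n i) (compactBasis n a.2)) Primrec.fst
    (primrecPred_const True).isSigmaOne (r := fun a k =>
    WayBelow (compactBasis n (k + 1)) (compactBasis n a.2)) ?_ (fun a => ?_) fun a k => Iff.rfl)
  · refine isSigmaOne_of_cases (p := fun (x : (ℕ × ℕ) × ℕ) j =>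
      WayBelow (compactBasis n (x.2 + 1)) (compactBasis n j)) (Primrec.snd.comp Primrec.fst)
      (primrecPred_const False).isSigmaOne (r := fun x l =>
        OpenCover n (boxList l) (boxList x.2) []) ?_ (fun x => ?_) fun x l => ?_
    · exact isSigmaOne_openCover hn (primrec_boxList Primrec.snd)
        (primrec_boxList (Primrec.snd.comp Primrec.fst)) (Primrec.const [])
    · rw [wayBelow_compact, carrier_compactBasis_succ]
      refine iff_false_intro fun h => ?_
      -- With at least one coordinate the space is not compact, so no finite union of boxes exhausts
      -- it.
      have : Nonempty (Fin n) := ⟨⟨0, hn⟩⟩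
      exact (isCompact_ratBoxes (n := n) (boxList x.2)).ne_univ
        (Set.univ_subset_iff.1 (h.trans interior_subset))
    · rw [wayBelow_compact, carrier_compactBasis_succ, carrier_compactBasis_succ, OpenCover]
      simp
  · rw [wayBelow_compact, compactBasis_zero]
    simp

/-! ### Computability of the maximum value and the maximum set -/

/-- Indices of the regions where a step with code `j` has values below the number with code `r`. -/
noncomputable def regionsBelow (n j r : ℕ) : List ℕ :=
  open Classical in
  ((effectiveSteps n j).filter fun w => (intervalBasis 1 w.2).carrier ⊆ below (codeReal r)).map
    Prod.fst

theorem primrec_regionsBelow {f g : α → ℕ} (hf : Primrec f) (hg : Primrec g) :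
    Primrec fun a => regionsBelow n (f a) (g a) := by
  classical
  have hR : PrimrecRel fun (w : ℕ × ℕ) (r : ℕ) =>
      (intervalBasis 1 w.2).carrier ⊆ below (codeReal r) :=
    (primrecPred_subset_below (Primrec.snd.comp Primrec.fst) Primrec.snd :
      PrimrecPred fun x : (ℕ × ℕ) × ℕ => _)
  have hfst : Primrec₂ fun (_ : α) (w : ℕ × ℕ) => w.1 := Primrec.fst.comp Primrec.snd
  refine (Primrec.list_map (hR.listFilter.comp ((primrec_effectiveSteps n).comp hf) hg)
    hfst).of_eq fun a => ?_
  unfold regionsBelow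
  congr

/-- A step function is below `r` at a point iff the point is interior to the region of a single step
with value below `r`; a uniform bound thus becomes a cover. -/
theorem everywhereBelow_stepBasis_iff (l C : List ℕ) (j r : ℕ) :
    EverywhereBelow ((⋃ k ∈ l, ratBox n k) \ interior (⋃ k ∈ C, ratBox n k)) (codeReal r)
      (stepBasis n j) ↔ OpenCover n l C (regionsBelow n j r) := by
  unfold EverywhereBelow OpenCover
  simp only [stepBasis_subset_below_iff, wayBelow_point]
  refine ⟨fun h x hx => or_iff_not_imp_left.2 fun hxC => ?_, ?_⟩
  · obtain ⟨w, hw, hxw, hwr⟩ := h x ⟨hx, hxC⟩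
    refine Set.mem_biUnion (List.mem_map.2 ⟨w, List.mem_filter.2 ⟨hw, by simpa using hwr⟩, rfl⟩) hxw
  · rintro h x ⟨hx, hxC⟩
    obtain ⟨o, ho, hxo⟩ := Set.mem_iUnion₂.1 ((h hx).resolve_left hxC)
    obtain ⟨w, hw, rfl⟩ := List.mem_map.1 ho
    obtain ⟨hw, hwr⟩ := List.mem_filter.1 hw
    exact ⟨w, hw, hxo, by simpa using hwr⟩

theorem somewhereAbove_stepBasis_iff (l : List ℕ) (j r : ℕ) :
    SomewhereAbove (⋃ k ∈ l, ratBox n k) (codeReal r) (stepBasis n j) ↔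
      ∃ w ∈ effectiveSteps n j,
        (∃ k ∈ l, (ratBox n k ∩ interior (intervalBasis n w.1).carrier).Nonempty) ∧
        (intervalBasis 1 w.2).carrier ⊆ above (codeReal r) := by
  unfold SomewhereAbove
  simp only [stepBasis_subset_above_iff, wayBelow_point]
  constructor
  · rintro ⟨x, hx, w, hw, hxw, hwr⟩
    obtain ⟨k, hk, hxk⟩ := Set.mem_iUnion₂.1 hx
    exact ⟨w, hw, ⟨k, hk, x, hxk, hxw⟩, hwr⟩
  · rintro ⟨w, hw, ⟨k, hk, x, hxk, hxw⟩, hwr⟩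
    exact ⟨x, Set.mem_biUnion hk hxk, w, hw, hxw, hwr⟩

theorem primrecPred_somewhereAbove (l : List ℕ) {f g : α → ℕ} (hf : Primrec f)
    (hg : Primrec g) : PrimrecPred fun a =>
      SomewhereAbove (⋃ k ∈ l, ratBox n k) (codeReal (g a)) (stepBasis n (f a)) := by
  simp only [somewhereAbove_stepBasis_iff]
  exact PrimrecPred.exists_mem ((primrec_effectiveSteps n).comp hf)
    ((PrimrecPred.exists_mem (Primrec.const l) (primrecPred_ratBox_inter_interior Primrec.snd
      (Primrec.fst.comp (Primrec.snd.comp Primrec.fst))).primrecRel).and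
      (primrecPred_subset_above (Primrec.snd.comp Primrec.snd)
        (hg.comp Primrec.fst))).primrecRel

theorem rePred_wayBelow_maxV (hn : 1 ≤ n) {l : List ℕ} (hl : (⋃ k ∈ l, ratBox n k).Nonempty) :
    REPred fun p : ℕ × ℕ =>
      WayBelow (intervalBasis 1 p.1) (maxV (stepBasis n p.2) (⋃ k ∈ l, ratBox n k)) := by
  refine IsSigmaOne.rePred (isSigmaOne_of_cases (p := fun (a : ℕ × ℕ) i =>
    WayBelow (intervalBasis 1 i) (maxV (stepBasis n a.2) (⋃ k ∈ l, ratBox n k))) Primrec.fst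
    (primrecPred_const True).isSigmaOne (r := fun a k =>
      -- With `C = []` in `OpenCover` nothing is removed from `X`, so the bound below is required on
      -- all of `X`.
      SomewhereAbove (⋃ k ∈ l, ratBox n k) (codeReal (lowerCode k 0)) (stepBasis n a.2) ∧
      OpenCover n l [] (regionsBelow n a.2 (upperCode k 0))) ?_ (fun a => ?_) fun a k => ?_)
  · have h2 : Primrec fun x : (ℕ × ℕ) × ℕ => x.1.2 := Primrec.snd.comp Primrec.fst
    exact (primrecPred_somewhereAbove l h2
      (primrec_lowerCode Primrec.snd (Primrec.const 0))).isSigmaOne.and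
      (isSigmaOne_openCover hn (Primrec.const l) (Primrec.const [])
        (primrec_regionsBelow h2 (primrec_upperCode Primrec.snd (Primrec.const 0))))
  · rw [wayBelow_interval, intervalBasis_zero]
    simp
  · rw [wayBelow_interval, carrier_intervalBasis_succ, ratBox_eq,
      maxV_subset_iff hl (isCompact_ratBoxes l), ← everywhereBelow_stepBasis_iff]
    simp

theorem rePred_wayBelow_maxS (hn : 1 ≤ n) {l : List ℕ} (hl : (⋃ k ∈ l, ratBox n k).Nonempty) :
    REPred fun p : ℕ × ℕ =>
      WayBelow (compactBasis n p.1) (maxS (stepBasis n p.2) (⋃ k ∈ l, ratBox n k)) := by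
  refine IsSigmaOne.rePred (isSigmaOne_of_cases (p := fun (a : ℕ × ℕ) i =>
    WayBelow (compactBasis n i) (maxS (stepBasis n a.2) (⋃ k ∈ l, ratBox n k))) Primrec.fst
    -- The two alternatives are those of `maxSet_subset_iff`; without open regions, `OpenCover` says
    -- that `X` itself lies in the interior of the compact basis element.
    (primrecPred_const True).isSigmaOne (r := fun a k => OpenCover n l (boxList k) [] ∨
      ∃ r, SomewhereAbove (⋃ k ∈ l, ratBox n k) (codeReal r) (stepBasis n a.2) ∧
        OpenCover n l (boxList k) (regionsBelow n a.2 r)) ?_ (fun a => ?_) fun a k => ?_)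
  · refine (isSigmaOne_openCover hn (Primrec.const l) (primrec_boxList Primrec.snd)
      (Primrec.const [])).or (IsSigmaOne.exists_nat ?_)
    have h2 : Primrec fun x : ((ℕ × ℕ) × ℕ) × ℕ => x.1.1.2 :=
      Primrec.snd.comp (Primrec.fst.comp Primrec.fst)
    exact (primrecPred_somewhereAbove l h2 Primrec.snd).isSigmaOne.and
      (isSigmaOne_openCover hn (Primrec.const l)
        (primrec_boxList (Primrec.snd.comp Primrec.fst)) (primrec_regionsBelow h2 Primrec.snd))
  · rw [wayBelow_compact, compactBasis_zero]
    simp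
  · rw [wayBelow_maxS_iff hl (isCompact_ratBoxes l), carrier_compactBasis_succ,
      maxSet_subset_iff (isCompact_ratBoxes l) isOpen_interior]
    simp only [everywhereBelow_stepBasis_iff]
    simp [OpenCover]

/-! ### Assembly: coded box unions, effectively given domains, main theorem -/

theorem IsRationalBoxUnion.exists_list {X : Set (Fin n → ℝ)} (hX : IsRationalBoxUnion X) :
    ∃ l : List ℕ, X = (⋃ k ∈ l, ratBox n k) ∧ X.Nonempty := by
  obtain ⟨S, hS, hle, rfl⟩ := hX
  choose! g hg using fun p hp => exists_ratBox_eq (hle p hp)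
  have key : (⋃ p ∈ S, Set.Icc (fun i => (p.1 i : ℝ)) (fun i => (p.2 i : ℝ))) =
      ⋃ k ∈ S.toList.map g, ratBox n k := by
    ext x
    simp only [Set.mem_iUnion, List.mem_map, Finset.mem_toList, exists_prop]
    constructor
    · rintro ⟨p, hp, hx⟩
      exact ⟨g p, ⟨p, hp, rfl⟩, (hg p hp).symm ▸ hx⟩
    · rintro ⟨_, ⟨p, hp, rfl⟩, hx⟩
      exact ⟨p, hp, hg p hp ▸ hx⟩
  refine ⟨_, key, ?_⟩
  obtain ⟨p, hp⟩ := hS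
  exact ⟨_, Set.mem_biUnion hp (Set.left_mem_Icc.2 fun i => Rat.cast_le.2 (hle p hp i))⟩

theorem isEffectivelyGiven_intervalBasis (hn : 1 ≤ n) :
    IsEffectivelyGiven (intervalBasis n) where
  dcpo := isSetDomain_interval.isDCPO
  bot := isBot_bot
  basis := isSetDomain_interval.isDomainBasis
  re := (primrecPred_wayBelow_interval hn Primrec.fst Primrec.snd).isSigmaOne.rePred

theorem isEffectivelyGiven_compactBasis (hn : 1 ≤ n) : IsEffectivelyGiven (compactBasis n) where
  dcpo := isSetDomain_compact.isDCPO
  bot := isBot_bot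
  basis := isSetDomain_compact.isDomainBasis
  re := rePred_wayBelow_compactBasis hn

theorem isEffectivelyGiven_stepBasis (hn : 1 ≤ n) : IsEffectivelyGiven (stepBasis n) where
  dcpo := isDCPO_intervalMap
  bot := by
    rw [stepBasis_eq, stepList_zero]
    exact isBot_stepFunction_nil
  basis := isDomainBasis_stepBasis
  re := (primrecPred_wayBelow_stepBasis hn).isSigmaOne.rePred

end Covers

theorem mainTheorem2 (n : ℕ) (hn : 1 ≤ n) (X : Set (Fin n → ℝ)) (hX : IsRationalBoxUnion X) :
    -- the domains involved are effectively given
    (IsEffectivelyGiven (stepBasis n) ∧ IsEffectivelyGiven (intervalBasis 1) ∧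
      IsEffectivelyGiven (intervalBasis n) ∧ IsEffectivelyGiven (compactBasis n)) ∧
    -- the maximum set is always a nonempty compact set
    (∀ f : IntervalMap n, (maxSet f X).Nonempty ∧ IsCompact (maxSet f X)) ∧
    -- computability of `maxV (·, X)`
    (IsTTEComputable (stepBasis n) (intervalBasis 1) (fun f : IntervalMap n => maxV f X) ∧
      IsEffectiveMap (stepBasis n) (intervalBasis 1) (fun f : IntervalMap n => maxV f X)) ∧
    -- computability of `maxS (·, X)`
    (IsTTEComputable (stepBasis n) (compactBasis n) (fun f : IntervalMap n => maxS f X) ∧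
      IsEffectiveMap (stepBasis n) (compactBasis n) (fun f : IntervalMap n => maxS f X)) := by
  obtain ⟨l, rfl, hne⟩ := hX.exists_list
  have hc : IsCompact (⋃ k ∈ l, ratBox n k) := isCompact_ratBoxes l
  exact ⟨⟨isEffectivelyGiven_stepBasis hn, isEffectivelyGiven_intervalBasis le_rfl,
      isEffectivelyGiven_intervalBasis hn, isEffectivelyGiven_compactBasis hn⟩,
    fun f => ⟨maxSet_nonempty f hne hc, isCompact_maxSet f hc⟩,
    computable_of_openAt isDomainBasis_stepBasis isSetDomain_interval.isDomainBasis isBot_bot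
      (fun i => openAt_maxV hne hc _) (rePred_wayBelow_maxV hn hne),
    computable_of_openAt isDomainBasis_stepBasis isSetDomain_compact.isDomainBasis isBot_bot
      (fun i => openAt_maxS hne hc _) (rePred_wayBelow_maxS hn hne)⟩
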